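/- A \emph{barycentric algebra} is a set $B$ with binary operations $+_a$, $a\in[0,1]$, such that $x+_1y=x$, $x+_ax=x$, $x+_ay=y+_{1-a}x$, and $(x+_ay)+_bz=x+_{ab}\bigl(y+_{\frac{(1-a)b}{1-ab}}z\bigr)$ whenever $a,b<1$. A subset $A$ is \emph{convex} if $x+_ay\in A$ for all $x,y\in A$, $a\in[0,1]$. A barycentric algebra with a topology is \emph{topological} if $(x,a,y)\mapsto x+_ay$ is jointly continuous from $B\times[0,1]\times B$ to $B$, where $[0,1]$ has its usual metric topology. Topological spaces are preordered by specialization: $x\le y$ iff every open neighborhood of $x$ contains $y$; $\uparrow A$ denotes the upward closure of $A$, and $A$ is \emph{saturated} if it is the intersection of its open neighborhoods (equivalently $A=\uparrow A$). Compactness does not include any separation property. $B$ is \emph{linearly separated} if for all $x,y\in B$ with $x\not\le y$ there is a lower semicontinuous map $\Lambda\colon B\to[0,\infty]$ that is affine, i.e. $\Lambda(x+_ay)=a\,\Lambda(x)+(1-a)\,\Lambda(y)$ for all $x,y\in B$, $a\in[0,1]$ (with $0\cdot\infty=0$), such that $\Lambda(x)>\Lambda(y)$. $B$ is \emph{locally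 convex-compact} if every point has a neighborhood base of convex compact sets. A \emph{convenient barycentric algebra} is a topological barycentric algebra that is linearly separated, locally convex-compact and sober. For a poset $P$, the Scott-open sets are the upwards-closed sets $U$ such that every non-empty directed family whose supremum exists and lies in $U$ has a member in $U$. $P$ is a \emph{dcpo} if every non-empty directed family has a supremum. Write $x\ll y$ if every non-empty directed $D\subseteq P$ whose supremum exists and is $\ge y$ contains an element $\ge x$; $P$ is \emph{continuous} if, for every $x$, the set $\{y\mid y\ll x\}$ is non-empty and directed, with supremum $x$. A \emph{d-barycentric algebra} is a barycentric algebra with a partial ordering that makes it a dcpo, such that every $+_a$ is monotonic and Scott-continuous, and such that for all $x,y$ the map $a\mapsto x+_ay$ is continuous from $[0,1]$ with its metric topology to the algebra with its Scott topology. For a topological barycentric algebra $B$, the \emph{Smyth poweralgebra} $\mathcal Q^{cvx}B$ is the set of all non-empty convex compact saturated subsets of $B$, ordered by reverse inclusion $\supseteq$; it is a barycentric algebra with $Q_1+_aQ_2=\uparrow\{x_1+_ax_2\mid x_1\in Q_1,\,x_2\in Q_2\}$. The \emph{upper Vietoris topology} on $\mathcal Q^{cvx}B$ is generated by the sets $\{Q\mid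 Q\subseteq U\}$, $U$ open in $B$. \textbf{Proposition.} Let $B$ be a convenient barycentric algebra. Then $\mathcal Q^{cvx}B$, with the Scott topology of $\supseteq$, is a linearly separated d-barycentric algebra whose underlying poset is continuous; in particular, it is a convenient barycentric algebra. Directed suprema in $\mathcal Q^{cvx}B$ are filtered intersections: for every non-empty family $D\subseteq\mathcal Q^{cvx}B$ that is directed with respect to $\supseteq$, $\bigcap D$ is an element of $\mathcal Q^{cvx}B$ and is the supremum of $D$. Moreover, the upper Vietoris topology on $\mathcal Q^{cvx}B$ coincides with the Scott topology of $\supseteq$. -/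

import Mathlib

open scoped ENNReal unitInterval Topology

/-- The weight `(1 - a) b / (1 - a b)` of the associativity law; it lies in `[0, 1]`
(with value `0` in the degenerate case `a = b = 1`, which the law excludes). -/
noncomputable def assocWeight (a b : I) : I :=
  ⟨(1 - (a : ℝ)) * b / (1 - (a : ℝ) * b), by
    have ha := a.2.1
    have ha' := a.2.2
    have hb := b.2.1
    have hb' := b.2.2
    have hab : (a : ℝ) * b ≤ 1 := mul_le_one₀ ha' hb hb'
    refine ⟨div_nonneg (mul_nonneg (by linarith) hb) (by linarith), ?_⟩
    exact div_le_one_of_le₀ (by nlinarith) (by linarith)⟩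

/-- Barycentric algebras: `bary a x y` is `x +_a y`, where `a` is the weight of `x`. -/
class BarycentricAlgebra (B : Type*) where
  bary : I → B → B → B
  bary_one : ∀ x y : B, bary 1 x y = x
  bary_self : ∀ (a : I) (x : B), bary a x x = x
  bary_symm : ∀ (a : I) (x y : B), bary a x y = bary (unitInterval.symm a) y x
  bary_assoc : ∀ (a b : I) (x y z : B), a < 1 → b < 1 →
    bary b (bary a x y) z = bary (a * b) x (bary (assocWeight a b) y z)

namespace BarycentricAlgebra

section Algebra

variable {B : Type*} [BarycentricAlgebra B]

theorem bary_zero (x y : B) : bary 0 x y = y := by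
  rw [bary_symm, unitInterval.symm_zero, bary_one]

/-- The entropic law. -/
theorem bary_entropic (a b : I) (x y z t : B) :
    bary b (bary a x y) (bary a z t) = bary a (bary b x z) (bary b y t) := by
  rcases eq_or_ne a 0 with rfl | ha0
  · simp only [bary_zero]
  rcases eq_or_ne b 0 with rfl | hb0
  · simp only [bary_zero]
  rcases eq_or_ne a 1 with rfl | ha1
  · simp only [bary_one]
  rcases eq_or_ne b 1 with rfl | hb1
  · simp only [bary_one]
  have ha : a < 1 := lt_of_le_of_ne a.2.2 ha1
  have hb : b < 1 := lt_of_le_of_ne b.2.2 hb1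
  have ha' : (a : ℝ) < 1 := ha
  have hb' : (b : ℝ) < 1 := hb
  have hapos : (0 : ℝ) < a := lt_of_le_of_ne a.2.1 (fun h => ha0 (Subtype.ext h.symm))
  have hbpos : (0 : ℝ) < b := lt_of_le_of_ne b.2.1 (fun h => hb0 (Subtype.ext h.symm))
  have hab : (0 : ℝ) < 1 - a * b := by nlinarith
  have hab2 : (1 : ℝ) - b * a ≠ 0 := by nlinarith
  have hcval : ((unitInterval.symm (assocWeight a b) : I) : ℝ) = (1 - b) / (1 - a * b) := by
    simp only [unitInterval.coe_symm_eq, assocWeight]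
    field_simp
    ring
  have hc : unitInterval.symm (assocWeight a b) < 1 := by
    rw [← Subtype.coe_lt_coe, hcval, Set.Icc.coe_one, div_lt_one hab]
    nlinarith
  rw [bary_assoc a b _ _ _ ha hb, bary_symm (assocWeight a b), bary_assoc a _ _ _ _ ha hc,
    bary_assoc b a _ _ _ hb ha]
  have e1 : a * b = b * a := mul_comm a b
  have e2 : a * unitInterval.symm (assocWeight a b) = assocWeight b a := by
    apply Subtype.ext
    rw [Set.Icc.coe_mul, hcval]
    simp only [assocWeight]
    field_simp
  have e3 : assocWeight a (unitInterval.symm (assocWeight a b)) = unitInterval.symm b := by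
    apply Subtype.ext
    simp only [assocWeight, unitInterval.coe_symm_eq] at hcval ⊢
    rw [hcval]
    have h1 : (1 : ℝ) - a * ((1 - b) / (1 - a * b)) = (1 - a) / (1 - a * b) := by
      field_simp
      ring
    rw [h1]
    have : (1 : ℝ) - a ≠ 0 := by linarith
    field_simp
  rw [e1, e2, e3, ← bary_symm b y t]

/-- Convex subsets of a barycentric algebra. -/
def IsConvex (A : Set B) : Prop :=
  ∀ ⦃x⦄, x ∈ A → ∀ ⦃y⦄, y ∈ A → ∀ a : I, bary a x y ∈ A

/-- Affine maps to the cone `[0, ∞]` (where `0 * ∞ = 0`). -/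
def IsAffineENNReal (Λ : B → ℝ≥0∞) : Prop :=
  ∀ (a : I) (x y : B),
    Λ (bary a x y) = ENNReal.ofReal a * Λ x + ENNReal.ofReal (1 - (a : ℝ)) * Λ y

end Algebra

/-- Topological barycentric algebras: `(x, a, y) ↦ x +_a y` is jointly continuous. -/
class IsTopological (B : Type*) [TopologicalSpace B] [BarycentricAlgebra B] : Prop where
  continuous_bary : Continuous fun p : B × I × B => bary p.2.1 p.1 p.2.2

/-- Linear separation. In the specialization preordering, `x ≤ y` means that every open
neighborhood of `x` contains `y`, which is `y ⤳ x` in Mathlib. Lower semicontinuity is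
continuity with respect to the Scott topology of `[0, ∞]`. -/
def LinearlySeparated (B : Type*) [TopologicalSpace B] [BarycentricAlgebra B] : Prop :=
  ∀ x y : B, ¬ (y ⤳ x) →
    ∃ Λ : B → ℝ≥0∞, IsAffineENNReal Λ ∧ LowerSemicontinuous Λ ∧ Λ y < Λ x

/-- Every point has a neighborhood base of convex compact sets. -/
def LocallyConvexCompact (B : Type*) [TopologicalSpace B] [BarycentricAlgebra B] : Prop :=
  ∀ (x : B), ∀ U ∈ 𝓝 x, ∃ K ∈ 𝓝 x, IsConvex K ∧ IsCompact K ∧ K ⊆ U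

/-- Convenient barycentric algebras: linearly separated, locally convex-compact, sober
topological barycentric algebras. (Sober spaces are the quasi-sober `T₀` spaces.) -/
class IsConvenient (B : Type*) [TopologicalSpace B] [BarycentricAlgebra B] : Prop
    extends IsTopological B, T0Space B, QuasiSober B where
  linearlySeparated : LinearlySeparated B
  locallyConvexCompact : LocallyConvexCompact B

/-- A poset in which every (non-empty) directed family has a supremum. -/
def IsDcpo (P : Type*) [PartialOrder P] : Prop :=
  ∀ D : Set P, D.Nonempty → DirectedOn (· ≤ ·) D → ∃ s, IsLUB D s

/-- The way-below relation of a poset. -/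
def WayBelow {P : Type*} [PartialOrder P] (x y : P) : Prop :=
  ∀ D : Set P, D.Nonempty → DirectedOn (· ≤ ·) D → ∀ s, IsLUB D s → y ≤ s → ∃ d ∈ D, x ≤ d

/-- Continuous posets: every `x` is the supremum of the directed set of all elements way below
`x`. -/
def IsContinuousPoset (P : Type*) [PartialOrder P] : Prop :=
  ∀ x : P, {y | WayBelow y x}.Nonempty ∧ DirectedOn (· ≤ ·) {y : P | WayBelow y x} ∧
    IsLUB {y | WayBelow y x} x

/-- s-barycentric algebras: ordered barycentric algebras in which each `+_a` is
Scott-continuous, and each `a ↦ x +_a y` is continuous from `[0, 1]` with its metric topology to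
the Scott topology. -/
structure IsSBarycentric (B : Type*) [PartialOrder B] [BarycentricAlgebra B] : Prop where
  monotone_bary : ∀ a : I, Monotone fun p : B × B => bary a p.1 p.2
  scottContinuous_bary : ∀ a : I, ScottContinuous fun p : B × B => bary a p.1 p.2
  continuous_weight : ∀ x y : B,
    @Continuous I B _ (Topology.scott B Set.univ) fun a => bary a x y

/-- d-barycentric algebras: s-barycentric algebras whose ordering is a dcpo. -/
structure IsDBarycentric (B : Type*) [PartialOrder B] [BarycentricAlgebra B] : Prop
    extends IsSBarycentric B where
  isDcpo : IsDcpo B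

/-- The elements of the Smyth poweralgebra: non-empty, convex, compact saturated subsets.
(`nhdsKer A` is the intersection of all open neighborhoods of `A`.) -/
@[ext]
structure Smyth (B : Type*) [TopologicalSpace B] [BarycentricAlgebra B] where
  carrier : Set B
  nonempty : carrier.Nonempty
  isConvex : IsConvex carrier
  isCompact : IsCompact carrier
  saturated : nhdsKer carrier = carrier

namespace Smyth

section Order

variable {B : Type*} [TopologicalSpace B] [BarycentricAlgebra B]

/-- The ordering of the Smyth poweralgebra is reverse inclusion. -/
instance : PartialOrder (Smyth B) where
  le Q₁ Q₂ := Q₂.carrier ⊆ Q₁.carrier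
  le_refl Q := Set.Subset.refl Q.carrier
  le_trans _ _ _ h₁ h₂ := Set.Subset.trans h₂ h₁
  le_antisymm _ _ h₁ h₂ := Smyth.ext (Set.Subset.antisymm h₂ h₁)

/-- The Smyth poweralgebra carries the Scott topology of reverse inclusion. -/
instance : TopologicalSpace (Smyth B) := Topology.scott (Smyth B) Set.univ

variable (B) in
/-- The upper Vietoris topology, generated by the sets `{Q | Q ⊆ U}`, `U` open. -/
@[reducible]
def upperVietoris : TopologicalSpace (Smyth B) :=
  TopologicalSpace.generateFrom
    {s | ∃ U : Set B, IsOpen U ∧ s = {Q : Smyth B | Q.carrier ⊆ U}}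

theorem mem_of_specializes {Q : Smyth B} {x z : B} (hx : x ∈ Q.carrier) (h : z ⤳ x) :
    z ∈ Q.carrier := by
  rw [← Q.saturated, mem_nhdsKer_iff_specializes]
  exact ⟨x, hx, h⟩

end Order

variable {B : Type*} [TopologicalSpace B] [BarycentricAlgebra B] [IsTopological B]

theorem specializes_bary (a : I) {x x' y y' : B} (hx : x ⤳ x') (hy : y ⤳ y') :
    bary a x y ⤳ bary a x' y' := by
  have hc : Continuous fun p : B × B => bary a p.1 p.2 :=
    (IsTopological.continuous_bary (B := B)).comp
      (continuous_fst.prodMk (continuous_const.prodMk continuous_snd))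
  exact (hx.prod hy).map hc

/-- `Q₁ +_a Q₂` is the upward closure `{z | ∃ x₁ ∈ Q₁, ∃ x₂ ∈ Q₂, x₁ +_a x₂ ≤ z}` of the set of
all `x₁ +_a x₂`, in the specialization preordering. -/
def add (a : I) (Q₁ Q₂ : Smyth B) : Smyth B where
  carrier := nhdsKer (Set.image2 (bary a) Q₁.carrier Q₂.carrier)
  nonempty := (Q₁.nonempty.image2 Q₂.nonempty).mono subset_nhdsKer
  isConvex := by
    intro x hx y hy b
    rw [mem_nhdsKer_iff_specializes] at hx hy ⊢
    obtain ⟨_, ⟨x₁, hx₁, x₂, hx₂, rfl⟩, hx⟩ := hx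
    obtain ⟨_, ⟨y₁, hy₁, y₂, hy₂, rfl⟩, hy⟩ := hy
    refine ⟨_, ⟨_, Q₁.isConvex hx₁ hy₁ b, _, Q₂.isConvex hx₂ hy₂ b, rfl⟩, ?_⟩
    rw [← bary_entropic]
    exact specializes_bary b hx hy
  isCompact := by
    rw [IsCompact.nhdsKer_iff, ← Set.image_prod]
    have hc : Continuous fun p : B × B => bary a p.1 p.2 :=
      (IsTopological.continuous_bary (B := B)).comp
        (continuous_fst.prodMk (continuous_const.prodMk continuous_snd))
    exact (Q₁.isCompact.prod Q₂.isCompact).image hc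
  saturated := nhdsKer_nhdsKer _

theorem mem_add {a : I} {Q₁ Q₂ : Smyth B} {z : B} :
    z ∈ (add a Q₁ Q₂).carrier ↔ ∃ x₁ ∈ Q₁.carrier, ∃ x₂ ∈ Q₂.carrier, z ⤳ bary a x₁ x₂ := by
  simp only [add, mem_nhdsKer_iff_specializes, Set.mem_image2]
  constructor
  · rintro ⟨_, ⟨x₁, h₁, x₂, h₂, rfl⟩, h⟩
    exact ⟨x₁, h₁, x₂, h₂, h⟩
  · rintro ⟨x₁, h₁, x₂, h₂, h⟩
    exact ⟨_, ⟨x₁, h₁, x₂, h₂, rfl⟩, h⟩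

/-- The Smyth poweralgebra is a barycentric algebra. -/
instance : BarycentricAlgebra (Smyth B) where
  bary := add
  bary_one Q₁ Q₂ := by
    ext z
    rw [mem_add]
    constructor
    · rintro ⟨x₁, h₁, x₂, -, h⟩
      rw [bary_one] at h
      exact mem_of_specializes h₁ h
    · intro hz
      obtain ⟨y, hy⟩ := Q₂.nonempty
      exact ⟨z, hz, y, hy, by rw [bary_one]⟩
  bary_self a Q := by
    ext z
    rw [mem_add]
    constructor
    · rintro ⟨x₁, h₁, x₂, h₂, h⟩
      exact mem_of_specializes (Q.isConvex h₁ h₂ a) h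
    · intro hz
      exact ⟨z, hz, z, hz, by rw [bary_self]⟩
  bary_symm a Q₁ Q₂ := by
    ext z
    rw [mem_add, mem_add]
    constructor
    · rintro ⟨x₁, h₁, x₂, h₂, h⟩
      exact ⟨x₂, h₂, x₁, h₁, by rwa [← bary_symm]⟩
    · rintro ⟨x₂, h₂, x₁, h₁, h⟩
      exact ⟨x₁, h₁, x₂, h₂, by rwa [bary_symm]⟩
  bary_assoc a b Q₁ Q₂ Q₃ ha hb := by
    ext z
    rw [mem_add, mem_add]
    constructor
    · rintro ⟨y, hy, x₃, h₃, h⟩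
      obtain ⟨x₁, h₁, x₂, h₂, hy⟩ := mem_add.1 hy
      refine ⟨x₁, h₁, _, mem_add.2 ⟨x₂, h₂, x₃, h₃, specializes_rfl⟩, ?_⟩
      rw [← bary_assoc a b _ _ _ ha hb]
      exact h.trans (specializes_bary b hy specializes_rfl)
    · rintro ⟨x₁, h₁, y, hy, h⟩
      obtain ⟨x₂, h₂, x₃, h₃, hy⟩ := mem_add.1 hy
      refine ⟨_, mem_add.2 ⟨x₁, h₁, x₂, h₂, specializes_rfl⟩, x₃, h₃, ?_⟩
      rw [bary_assoc a b _ _ _ ha hb]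
      exact h.trans (specializes_bary _ specializes_rfl hy)

end Smyth

end BarycentricAlgebra

/-! Everything rests on `exists_subset_interior`: inside any open neighborhood `U` of `Q` there is a
convex compact saturated neighborhood of `Q`. Granted this, the `Q'` with `Q` in their interior form
a directed family with supremum `Q`, and well-filteredness of sober spaces makes them way below `Q`.
Continuity of the poset, the comparison of topologies, local convex-compactness and sobriety follow.
Linear separation is inherited by sending a functional to its minimum on `Q`.

For the neighborhood itself, finitely many small convex compact sets cover `Q`, but their convex
hull might leave `U`. Take ever finer covers, arranged so that their unions shrink to a convex
compact `A ⊆ U`. If every hull left `U`, then at each stage the weights whose combination of the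
cover leaves `U` would form a non-empty compact space, and refinement maps these spaces into one
another. A point of the inverse limit gives a decreasing sequence of combinations, whose
intersection contains some `y ∉ U` by well-filteredness. A lower semicontinuous affine functional
with value at most 1 at `y` and above 1 on `A` is above 1 on all members of some cover, hence on a
combination containing `y`: a contradiction.

This needs separation of points from convex compact sets (`LinearlySeparated.exists_affine_lt`, a
minimax argument by connectedness) and finite combinations of elements of the Smyth poweralgebra,
upper semicontinuous in the weights (`isOpen_setOf_combination_subset`). -/

open Set

/-! ### Well-filteredness and semicontinuity. -/

/-- Sober spaces are well-filtered. -/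
theorem exists_subset_of_iInter_subset_of_quasiSober {X ι : Type*} [TopologicalSpace X]
    [QuasiSober X] [Nonempty ι] {K : ι → Set X} (hdir : Directed (· ⊇ ·) K)
    (hc : ∀ i, IsCompact (K i)) (hs : ∀ i, nhdsKer (K i) = K i) {U : Set X} (hU : IsOpen U)
    (h : ⋂ i, K i ⊆ U) : ∃ i, K i ⊆ U := by
  by_contra! hne
  -- A minimal closed set that misses `U` and meets every `K i` will be irreducible; its generic
  -- point lies in every `K i`, but not in `U`.
  obtain ⟨C, ⟨hCc, hCU, hCK⟩, hmin⟩ := zorn_superset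
    {C : Set X | IsClosed C ∧ C ⊆ Uᶜ ∧ ∀ i, (K i ∩ C).Nonempty} (by
      intro c hcS hchain
      rcases c.eq_empty_or_nonempty with rfl | hcne
      · refine ⟨Uᶜ, ⟨hU.isClosed_compl, Subset.rfl, fun i => ?_⟩, by simp⟩
        obtain ⟨x, hx, hxU⟩ := not_subset.1 (hne i)
        exact ⟨x, hx, hxU⟩
      · refine ⟨⋂₀ c, ⟨isClosed_sInter fun s hs => (hcS hs).1, ?_, fun i => ?_⟩,
          fun s hs => sInter_subset_of_mem hs⟩
        · obtain ⟨s, hs⟩ := hcne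
          exact (sInter_subset_of_mem hs).trans (hcS hs).2.1
        · by_contra hemp
          have := hcne.to_subtype
          obtain ⟨s, hs⟩ := (hc i).elim_directed_family_closed (fun s : c => (s : Set X))
            (fun s => (hcS s.2).1) (by rw [← sInter_eq_iInter]; exact not_nonempty_iff_eq_empty.1 hemp)
            (by
              intro s t
              rcases hchain.total s.2 t.2 with hst | hst
              · exact ⟨s, Subset.rfl, hst⟩
              · exact ⟨t, hst, Subset.rfl⟩)
          exact ((hcS s.2).2.2 i).ne_empty hs)
  have hirr : IsIrreducible C := by
    refine ⟨(hCK (Classical.arbitrary ι)).mono inter_subset_right, ?_⟩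
    rw [isPreirreducible_iff_isClosed_union_isClosed]
    intro z₁ z₂ h₁ h₂ hz
    by_contra! hcon
    -- By minimality, a proper closed part `C ∩ z` must miss some `K i`.
    have key : ∀ z : Set X, IsClosed z → ¬ C ⊆ z → ∃ i, ∀ y ∈ K i, y ∈ C → y ∉ z := by
      intro z hz hCz
      by_contra! hall
      refine hCz fun x hx => ?_
      have := hmin (y := C ∩ z) ⟨hCc.inter hz, inter_subset_left.trans hCU, fun i => ?_⟩
        inter_subset_left hx
      · exact this.2
      · obtain ⟨y, h1, h2, h3⟩ := hall i
        exact ⟨y, h1, h2, h3⟩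
    obtain ⟨i, hi⟩ := key z₁ h₁ hcon.1
    obtain ⟨j, hj⟩ := key z₂ h₂ hcon.2
    obtain ⟨k, hki, hkj⟩ := hdir i j
    obtain ⟨y, hyK, hyC⟩ := hCK k
    rcases hz hyC with h | h
    · exact hi y (hki hyK) hyC h
    · exact hj y (hkj hyK) hyC h
  obtain ⟨x, hx⟩ := QuasiSober.sober hirr hCc
  refine hCU hx.mem (h (mem_iInter.2 fun i => ?_))
  obtain ⟨y, hyK, hyC⟩ := hCK i
  rw [← hs i, mem_nhdsKer_iff_specializes]
  exact ⟨y, hyK, hx.specializes hyC⟩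

theorem isCompact_iInter_of_quasiSober {X ι : Type*} [TopologicalSpace X]
    [QuasiSober X] [Nonempty ι] {K : ι → Set X} (hdir : Directed (· ⊇ ·) K)
    (hc : ∀ i, IsCompact (K i)) (hs : ∀ i, nhdsKer (K i) = K i) : IsCompact (⋂ i, K i) := by
  refine isCompact_of_finite_subcover fun U hU hcov => ?_
  obtain ⟨i, hi⟩ :=
    exists_subset_of_iInter_subset_of_quasiSober hdir hc hs (isOpen_iUnion hU) hcov
  obtain ⟨t, ht⟩ := (hc i).elim_finite_subcover U hU hi
  exact ⟨t, (iInter_subset _ i).trans ht⟩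

theorem nhdsKer_iInter_eq {X ι : Type*} [TopologicalSpace X] {K : ι → Set X}
    (hs : ∀ i, nhdsKer (K i) = K i) : nhdsKer (⋂ i, K i) = ⋂ i, K i :=
  (nhdsKer_iInter_subset.trans (iInter_mono fun i => (hs i).subset)).antisymm subset_nhdsKer

/-- A product in `[0, ∞]` is the supremum of the products of strictly smaller factors, so the
convention `0 * ∞ = 0` does no harm. -/
theorem LowerSemicontinuous.ennreal_mul {X : Type*} [TopologicalSpace X] {f g : X → ℝ≥0∞}
    (hf : LowerSemicontinuous f) (hg : LowerSemicontinuous g) :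
    LowerSemicontinuous fun x => f x * g x := by
  intro x r hr
  have : ∃ a < f x, ∃ b < g x, r < a * b := by
    by_contra! hcon
    exact absurd (ENNReal.mul_le_of_forall_lt hcon) (not_le.2 hr)
  obtain ⟨a, ha, b, hb, hab⟩ := this
  filter_upwards [hf x a ha, hg x b hb] with y hy hy'
  exact hab.trans_le (mul_le_mul' hy.le hy'.le)

/-! ### Separation of convex compact sets from points. -/

namespace BarycentricAlgebra

section Separation

variable {B : Type*} [BarycentricAlgebra B]

theorem IsConvex.inter {A A' : Set B} (h : IsConvex A) (h' : IsConvex A') : IsConvex (A ∩ A') :=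
  fun _ hx _ hy a => ⟨h hx.1 hy.1 a, h' hx.2 hy.2 a⟩

theorem ofReal_add_ofReal_symm (a : I) :
    ENNReal.ofReal a + ENNReal.ofReal (1 - (a : ℝ)) = 1 := by
  rw [← ENNReal.ofReal_add a.2.1 (by linarith [a.2.2])]
  simp

theorem IsAffineENNReal.isConvex_le {Λ : B → ℝ≥0∞} (h : IsAffineENNReal Λ) (r : ℝ≥0∞) :
    IsConvex {x | Λ x ≤ r} := by
  intro x hx y hy a
  calc Λ (bary a x y) = _ := h a x y
    _ ≤ ENNReal.ofReal a * r + ENNReal.ofReal (1 - (a : ℝ)) * r :=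
      add_le_add (mul_le_mul_right hx _) (mul_le_mul_right hy _)
    _ = r := by rw [← add_mul, ofReal_add_ofReal_symm, one_mul]

theorem lt_ofReal_mul_add {r u v : ℝ≥0∞} (hu : r < u) (hv : r < v) (a : I) :
    r < ENNReal.ofReal a * u + ENNReal.ofReal (1 - (a : ℝ)) * v := by
  calc r < min u v := lt_min hu hv
    _ = ENNReal.ofReal a * min u v + ENNReal.ofReal (1 - (a : ℝ)) * min u v := by
      rw [← add_mul, ofReal_add_ofReal_symm, one_mul]
    _ ≤ _ := add_le_add (mul_le_mul_right (min_le_left _ _) _)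
      (mul_le_mul_right (min_le_right _ _) _)

theorem IsAffineENNReal.isConvex_lt {Λ : B → ℝ≥0∞} (h : IsAffineENNReal Λ) (r : ℝ≥0∞) :
    IsConvex {x | r < Λ x} := by
  intro x hx y hy a
  have := lt_ofReal_mul_add (r := r) hx hy a
  rwa [← h a x y] at this

theorem IsAffineENNReal.const_mul {Λ : B → ℝ≥0∞} (h : IsAffineENNReal Λ) (c : ℝ≥0∞) :
    IsAffineENNReal fun x => c * Λ x := by
  intro a x y
  simp only [h a x y]
  ring

theorem IsAffineENNReal.add {Λ Λ' : B → ℝ≥0∞} (h : IsAffineENNReal Λ)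
    (h' : IsAffineENNReal Λ') : IsAffineENNReal fun x => Λ x + Λ' x := by
  intro a x y
  simp only [h a x y, h' a x y]
  ring

variable [TopologicalSpace B]

theorem continuous_bary [IsTopological B] {X : Type*} [TopologicalSpace X] {a : X → I}
    {f g : X → B} (ha : Continuous a) (hf : Continuous f) (hg : Continuous g) :
    Continuous fun x => bary (a x) (f x) (g x) :=
  IsTopological.continuous_bary.comp (hf.prodMk (ha.prodMk hg))

/-- If two open half-spaces cover a convex compact set, then some convex combination of the two
functionals defines a half-space that contains the set. -/
theorem exists_weight_lt_of_forall_or [IsTopological B] {Q : Set B} (hQ : IsConvex Q)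
    (hQc : IsCompact Q) {Λ Λ' : B → ℝ≥0∞} (hΛ : IsAffineENNReal Λ) (hΛc : LowerSemicontinuous Λ)
    (hΛ' : IsAffineENNReal Λ') (hΛc' : LowerSemicontinuous Λ') {r : ℝ≥0∞}
    (h : ∀ x ∈ Q, r < Λ x ∨ r < Λ' x) :
    ∃ a : I, ∀ x ∈ Q, r < ENNReal.ofReal a * Λ x + ENNReal.ofReal (1 - (a : ℝ)) * Λ' x := by
  by_contra! hcon
  set F : I → B → ℝ≥0∞ := fun a x =>
    ENNReal.ofReal a * Λ x + ENNReal.ofReal (1 - (a : ℝ)) * Λ' x with hF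
  have hFc : LowerSemicontinuous fun p : B × I => F p.2 p.1 := by
    refine LowerSemicontinuous.add (LowerSemicontinuous.ennreal_mul ?_ (hΛc.comp continuous_fst))
      (LowerSemicontinuous.ennreal_mul ?_ (hΛc'.comp continuous_fst))
    · exact (ENNReal.continuous_ofReal.comp (by fun_prop)).lowerSemicontinuous
    · exact (ENNReal.continuous_ofReal.comp (by fun_prop)).lowerSemicontinuous
  have hFa : ∀ a, IsAffineENNReal (F a) := fun a => (hΛ.const_mul _).add (hΛ'.const_mul _)
  -- Projecting a compact subset of `Q × I`. For `M = Λ` and `M = Λ'` these closed sets cover `I`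
  -- and contain `1` and `0` respectively, so by connectedness they share a weight `a`.
  have hcl : ∀ M : B → ℝ≥0∞, LowerSemicontinuous M →
      IsClosed {a : I | ∃ x ∈ Q, F a x ≤ r ∧ M x ≤ r} := by
    intro M hM
    have hK : IsCompact ((Q ×ˢ (univ : Set I)) ∩
        ({p | F p.2 p.1 ≤ r} ∩ {p | M p.1 ≤ r})) :=
      (hQc.prod isCompact_univ).inter_right ((hFc.isClosed_preimage r).inter
        ((hM.comp continuous_fst).isClosed_preimage r))
    convert! (hK.image continuous_snd).isClosed using 1
    ext a
    constructor
    · rintro ⟨x, hx, h1, h2⟩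
      exact ⟨(x, a), ⟨⟨hx, mem_univ _⟩, h1, h2⟩, rfl⟩
    · rintro ⟨⟨x, a'⟩, ⟨⟨hx, -⟩, h1, h2⟩, rfl⟩
      exact ⟨x, hx, h1, h2⟩
  obtain ⟨a, -, ⟨x, hx, hFx, hxΛ⟩, ⟨y, hy, hFy, hyΛ⟩⟩ := isPreconnected_closed_iff.1
    (isPreconnected_univ (α := I)) _ _ (hcl Λ hΛc) (hcl Λ' hΛc') (by
      intro a _
      obtain ⟨x, hx, hFx⟩ := hcon a
      by_contra! hno
      simp only [mem_union, mem_ofPred_eq, not_or, not_exists, not_and, not_le] at hno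
      exact absurd hFx (not_le.2 (lt_ofReal_mul_add (hno.1 x hx hFx) (hno.2 x hx hFx) a)))
    (by
      obtain ⟨x, hx, hFx⟩ := hcon 1
      exact ⟨1, mem_univ _, x, hx, hFx, by simpa using hFx⟩)
    (by
      obtain ⟨x, hx, hFx⟩ := hcon 0
      exact ⟨0, mem_univ _, x, hx, hFx, by simpa using hFx⟩)
  -- With `a` fixed, connectedness is used again along the segment from `x` to `y`: it stays in `Q`
  -- and in `F a ≤ r`, so each of its points has `Λ ≤ r` or `Λ' ≤ r`, and some point has both.
  have hpath : Continuous fun t : I => bary t x y :=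
    continuous_bary continuous_id continuous_const continuous_const
  have hmem : ∀ t : I, bary t x y ∈ Q ∩ {z | F a z ≤ r} := fun t =>
    (hQ.inter ((hFa a).isConvex_le r)) ⟨hx, hFx⟩ ⟨hy, hFy⟩ t
  obtain ⟨t, -, ht, ht'⟩ := isPreconnected_closed_iff.1
    (isPreconnected_univ (α := I)) _ _ ((hΛc.isClosed_preimage r).preimage hpath)
    ((hΛc'.isClosed_preimage r).preimage hpath) (by
      intro t _
      by_contra! hno
      simp only [mem_union, mem_preimage, mem_Iic, not_or, not_le] at hno
      exact absurd (hmem t).2 (not_le.2 (lt_ofReal_mul_add hno.1 hno.2 a)))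
    ⟨1, mem_univ _, by simpa [bary_one] using hxΛ⟩ ⟨0, mem_univ _, by simpa [bary_zero] using hyΛ⟩
  rcases h _ (hmem t).1 with h1 | h1
  · exact absurd ht (not_le.2 h1)
  · exact absurd ht' (not_le.2 h1)

/-- Functionals are merged one at a time. The set `Q` varies in the induction: the remaining
functionals only have to deal with the convex compact part of `Q` where the new one is at most `r`.
-/
theorem exists_affine_lt_of_forall_exists_finset [IsTopological B] (y : B) (r : ℝ≥0∞)
    (T : Finset (B → ℝ≥0∞)) (hT : ∀ Λ ∈ T, IsAffineENNReal Λ ∧ LowerSemicontinuous Λ ∧ Λ y ≤ r) :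
    ∀ Q : Set B, IsConvex Q → IsCompact Q → (∀ x ∈ Q, ∃ Λ ∈ T, r < Λ x) →
    ∃ Λ : B → ℝ≥0∞, IsAffineENNReal Λ ∧ LowerSemicontinuous Λ ∧ Λ y ≤ r ∧ ∀ x ∈ Q, r < Λ x := by
  classical
  induction T using Finset.induction_on with
  | empty =>
    intro Q _ _ h
    refine ⟨fun _ => 0, fun a x y => by simp, lowerSemicontinuous_const, by simp, fun x hx => ?_⟩
    obtain ⟨Λ, hΛ, -⟩ := h x hx
    simp at hΛ
  | insert Λ T _ ih =>
    intro Q hQ hQc h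
    obtain ⟨ha, hc, hy⟩ := hT Λ (Finset.mem_insert_self _ _)
    obtain ⟨Λ', ha', hc', hy', h'⟩ := ih (fun M hM => hT M (Finset.mem_insert_of_mem hM))
      (Q ∩ {x | Λ x ≤ r}) (hQ.inter (ha.isConvex_le r))
      (hQc.inter_right (hc.isClosed_preimage r)) (by
        rintro x ⟨hx, hxr⟩
        obtain ⟨M, hM, hxM⟩ := h x hx
        rcases Finset.mem_insert.1 hM with rfl | hM
        · exact absurd hxM (not_lt.2 hxr)
        · exact ⟨M, hM, hxM⟩)
    obtain ⟨a, hlt⟩ := exists_weight_lt_of_forall_or (r := r) hQ hQc ha hc ha' hc' (by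
      intro x hx
      by_cases hxr : Λ x ≤ r
      · exact Or.inr (h' x ⟨hx, hxr⟩)
      · exact Or.inl (not_le.1 hxr))
    refine ⟨_, (ha.const_mul _).add (ha'.const_mul _), ?_, ?_, hlt⟩
    · exact (LowerSemicontinuous.ennreal_mul lowerSemicontinuous_const hc).add
        (LowerSemicontinuous.ennreal_mul lowerSemicontinuous_const hc')
    · calc _ ≤ ENNReal.ofReal a * r + ENNReal.ofReal (1 - (a : ℝ)) * r :=
          add_le_add (mul_le_mul_right hy _) (mul_le_mul_right hy' _)
        _ = r := by rw [← add_mul, ofReal_add_ofReal_symm, one_mul]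

/-- In linearly separated algebras, convex compact saturated sets are separated from the points
outside them by open half-spaces. -/
theorem LinearlySeparated.exists_affine_lt [IsTopological B] (hB : LinearlySeparated B)
    (Q : Smyth B) {y : B} (hy : y ∉ Q.carrier) :
    ∃ Λ : B → ℝ≥0∞, IsAffineENNReal Λ ∧ LowerSemicontinuous Λ ∧ Λ y ≤ 1 ∧
      ∀ x ∈ Q.carrier, 1 < Λ x := by
  classical
  have hpt : ∀ x : Q.carrier, ∃ Λ : B → ℝ≥0∞, IsAffineENNReal Λ ∧ LowerSemicontinuous Λ ∧
      Λ y ≤ 1 ∧ 1 < Λ x := by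
    intro x
    obtain ⟨Λ, ha, hc, hlt⟩ := hB x y fun h => hy (Smyth.mem_of_specializes x.2 h)
    obtain ⟨r, hyr, hrx⟩ := exists_between hlt
    have hr0 : r ≠ 0 := (zero_le.trans_lt hyr).ne'
    have hrt : r ≠ ⊤ := hrx.ne_top
    -- Rescaling gives all points of `Q` the same threshold `1`.
    refine ⟨fun z => r⁻¹ * Λ z, ha.const_mul _,
      LowerSemicontinuous.ennreal_mul lowerSemicontinuous_const hc, ?_, ?_⟩
    · calc r⁻¹ * Λ y ≤ r⁻¹ * r := mul_le_mul_right hyr.le _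
        _ = 1 := ENNReal.inv_mul_cancel hr0 hrt
    · calc 1 = r⁻¹ * r := (ENNReal.inv_mul_cancel hr0 hrt).symm
        _ < r⁻¹ * Λ x :=
          (ENNReal.mul_lt_mul_iff_right (ENNReal.inv_ne_zero.2 hrt) (ENNReal.inv_ne_top.2 hr0)).2 hrx
  choose Λ ha hc hle hlt using hpt
  obtain ⟨t, ht⟩ := Q.isCompact.elim_finite_subcover (fun x => {z | 1 < Λ x z})
    (fun x => (hc x).isOpen_preimage 1) (fun x hx => mem_iUnion.2 ⟨⟨x, hx⟩, hlt ⟨x, hx⟩⟩)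
  refine exists_affine_lt_of_forall_exists_finset y 1 (t.image Λ) ?_ _ Q.isConvex Q.isCompact ?_
  · intro M hM
    obtain ⟨x, -, rfl⟩ := Finset.mem_image.1 hM
    exact ⟨ha x, hc x, hle x⟩
  · intro x hx
    obtain ⟨i, hi, hxi⟩ := mem_iUnion₂.1 (ht hx)
    exact ⟨Λ i, Finset.mem_image_of_mem _ hi, hxi⟩

end Separation

end BarycentricAlgebra

/-! ### The cone over a barycentric algebra. -/

namespace BarycentricAlgebra

/-- The non-zero elements of the cone generated by a barycentric algebra: points with a positive
mass. -/
@[ext]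
structure MassPoint (P : Type*) where
  point : P
  mass : ℝ
  pos : 0 < mass

section Cone

variable {P : Type*}

/-- The element of the cone with mass `r` at `x`. -/
noncomputable def massAt (r : ℝ) (x : P) : WithZero (MassPoint P) :=
  -- Negative masses also give `0`, so additivity in `r` needs nonnegative masses.
  if h : 0 < r then ((⟨x, r, h⟩ : MassPoint P) : WithZero (MassPoint P)) else 0

theorem massAt_of_pos {r : ℝ} (h : 0 < r) (x : P) :
    massAt r x = ((⟨x, r, h⟩ : MassPoint P) : WithZero (MassPoint P)) := dif_pos h

@[simp]
theorem massAt_zero (x : P) : massAt 0 x = 0 := dif_neg (lt_irrefl _)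

theorem massAt_one_injective {x y : P} (h : massAt 1 x = massAt 1 y) : x = y := by
  rw [massAt_of_pos one_pos, massAt_of_pos one_pos, WithZero.coe_inj, MassPoint.mk.injEq] at h
  exact h.1

variable [BarycentricAlgebra P]

/-- The proportion of `r` in `r + s`. -/
noncomputable def proportion {r s : ℝ} (hr : 0 < r) (hs : 0 < s) : I :=
  ⟨r / (r + s), by positivity, div_le_one_of_le₀ (by linarith) (by positivity)⟩

noncomputable instance : Add (MassPoint P) where
  add u v := ⟨bary (proportion u.pos v.pos) u.point v.point, u.mass + v.mass, add_pos u.pos v.pos⟩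

theorem MassPoint.add_def (u v : MassPoint P) : u + v =
    ⟨bary (proportion u.pos v.pos) u.point v.point, u.mass + v.mass, add_pos u.pos v.pos⟩ := rfl

/-- The weights in the barycentric laws are exactly the proportions that occur when masses are
added; no cancellation law is needed. Finite sums thus make sense, and identities between
barycenters reduce to bookkeeping of masses. -/
noncomputable instance : AddCommSemigroup (MassPoint P) where
  add_assoc := by
    rintro ⟨x, r, hr⟩ ⟨y, s, hs⟩ ⟨z, t, ht⟩
    simp only [MassPoint.add_def, MassPoint.mk.injEq]
    refine ⟨?_, add_assoc r s t⟩
    rw [bary_assoc]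
    · have h1 : proportion hr hs * proportion (add_pos hr hs) ht =
          proportion hr (add_pos hs ht) := by
        apply Subtype.ext
        simp only [proportion, Set.Icc.coe_mul]
        field_simp
        ring
      have h2 : assocWeight (proportion hr hs) (proportion (add_pos hr hs) ht) =
          proportion hs ht := by
        apply Subtype.ext
        simp only [assocWeight, proportion]
        have e1 : 1 - r / (r + s) * ((r + s) / (r + s + t)) = (s + t) / (r + s + t) := by
          field_simp
          ring
        rw [e1]
        field_simp
        ring
      rw [h1, h2]
    · rw [← Subtype.coe_lt_coe]
      simp only [proportion, Set.Icc.coe_one]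
      rw [div_lt_one (by positivity)]
      linarith
    · rw [← Subtype.coe_lt_coe]
      simp only [proportion, Set.Icc.coe_one]
      rw [div_lt_one (by positivity)]
      linarith
  add_comm := by
    rintro ⟨x, r, hr⟩ ⟨y, s, hs⟩
    simp only [MassPoint.add_def, MassPoint.mk.injEq]
    refine ⟨?_, add_comm r s⟩
    rw [bary_symm]
    congr 1
    apply Subtype.ext
    simp only [proportion, unitInterval.coe_symm_eq]
    field_simp
    ring

theorem massAt_bary {r : ℝ} (hr : 0 ≤ r) (a : I) (x y : P) :
    massAt r (bary a x y) = massAt (a * r) x + massAt ((1 - a) * r) y := by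
  rcases hr.eq_or_lt with rfl | hr
  · simp
  rcases a.2.1.eq_or_lt with ha | ha
  · have : a = 0 := Subtype.ext ha.symm
    subst this
    simp [bary_zero]
  rcases a.2.2.eq_or_lt with ha' | ha'
  · have : a = 1 := Subtype.ext ha'
    subst this
    simp [bary_one]
  have h1 : 0 < (a : ℝ) * r := mul_pos ha hr
  have h2 : 0 < (1 - (a : ℝ)) * r := mul_pos (by linarith) hr
  rw [massAt_of_pos hr, massAt_of_pos h1, massAt_of_pos h2, ← WithZero.coe_add,
    MassPoint.add_def, WithZero.coe_inj, MassPoint.mk.injEq]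
  have e : proportion h1 h2 = a := by
    apply Subtype.ext
    simp only [proportion]
    field_simp
    ring
  exact ⟨by rw [e], by ring⟩

theorem massAt_add {r s : ℝ} (hr : 0 ≤ r) (hs : 0 ≤ s) (x : P) :
    massAt (r + s) x = massAt r x + massAt s x := by
  rcases hr.eq_or_lt with rfl | hr
  · simp
  have h := massAt_bary (add_pos_of_pos_of_nonneg hr hs).le
    ⟨r / (r + s), by positivity, div_le_one_of_le₀ (by linarith) (by positivity)⟩ x x
  rw [bary_self] at h
  rw [h]
  have : r + s ≠ 0 := by positivity
  congr 2
  · field_simp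
  · field_simp
    ring

theorem massAt_sum {ι : Type*} (t : Finset ι) {a : ι → ℝ} (ha : ∀ i ∈ t, 0 ≤ a i) (x : P) :
    massAt (∑ i ∈ t, a i) x = ∑ i ∈ t, massAt (a i) x := by
  classical
  induction t using Finset.induction_on with
  | empty => simp
  | insert i t hi ih =>
    rw [Finset.sum_insert hi, Finset.sum_insert hi, massAt_add (ha i (Finset.mem_insert_self _ _))
      (Finset.sum_nonneg fun j hj => ha j (Finset.mem_insert_of_mem hj)),
      ih fun j hj => ha j (Finset.mem_insert_of_mem hj)]

/-- The total mass. -/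
noncomputable def totalMass : WithZero (MassPoint P) →+ ℝ :=
  WithZero.lift ⟨MassPoint.mass, fun _ _ => rfl⟩

theorem totalMass_massAt {r : ℝ} (hr : 0 ≤ r) (x : P) : totalMass (massAt r x) = r := by
  rcases hr.eq_or_lt with rfl | hr
  · simp
  · rw [massAt_of_pos hr]
    rfl

theorem exists_massAt_eq (u : WithZero (MassPoint P)) (hu : totalMass u = 1) :
    ∃ x, massAt 1 x = u := by
  rcases eq_or_ne u 0 with rfl | hu0
  · simp at hu
  · obtain ⟨v, rfl⟩ := WithZero.ne_zero_iff_exists.1 hu0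
    obtain ⟨x, r, hr⟩ := v
    have : r = 1 := hu
    subst this
    exact ⟨x, massAt_of_pos one_pos x⟩

/-- Rescaling of masses by a positive number. -/
noncomputable def scale {t : ℝ} (ht : 0 < t) : WithZero (MassPoint P) →+ WithZero (MassPoint P) :=
  WithZero.mapAddHom
    { toFun := fun u => ⟨u.point, t * u.mass, mul_pos ht u.pos⟩
      map_add' := fun u v => by
        simp only [MassPoint.add_def, MassPoint.mk.injEq]
        refine ⟨?_, mul_add _ _ _⟩
        congr 1
        apply Subtype.ext
        have := u.pos
        have := v.pos
        simp only [proportion]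
        field_simp }

theorem scale_massAt {t : ℝ} (ht : 0 < t) {r : ℝ} (hr : 0 ≤ r) (x : P) :
    scale ht (massAt r x) = massAt (t * r) x := by
  rcases hr.eq_or_lt with rfl | hr
  · simp
  · rw [massAt_of_pos hr, massAt_of_pos (mul_pos ht hr)]
    rfl

end Cone

/-! ### Finite convex combinations. -/

section Combination

variable {P P' ι κ : Type*} [BarycentricAlgebra P] [BarycentricAlgebra P'] [Fintype ι] [Fintype κ]

theorem exists_massAt_eq_sum (a : stdSimplex ℝ ι) (p : ι → P) :
    ∃ x, massAt 1 x = ∑ i, massAt (a i) (p i) := by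
  refine exists_massAt_eq _ ?_
  rw [map_sum]
  simp only [totalMass_massAt (stdSimplex.zero_le a _), stdSimplex.sum_eq_one]

/-- The barycenter of finitely many points with given weights. -/
noncomputable def combination (a : stdSimplex ℝ ι) (p : ι → P) : P :=
  (exists_massAt_eq_sum a p).choose

theorem massAt_combination (a : stdSimplex ℝ ι) (p : ι → P) :
    massAt 1 (combination a p) = ∑ i, massAt (a i) (p i) :=
  (exists_massAt_eq_sum a p).choose_spec

theorem eq_combination {a : stdSimplex ℝ ι} {p : ι → P} {x : P}
    (h : massAt 1 x = ∑ i, massAt (a i) (p i)) : x = combination a p :=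
  massAt_one_injective (h.trans (massAt_combination a p).symm)

theorem massAt_combination_of_nonneg {r : ℝ} (hr : 0 ≤ r) (a : stdSimplex ℝ ι) (p : ι → P) :
    massAt r (combination a p) = ∑ i, massAt (r * a i) (p i) := by
  rcases hr.eq_or_lt with rfl | hr
  · simp
  have h := congrArg (scale hr) (massAt_combination a p)
  rw [scale_massAt hr zero_le_one, mul_one, map_sum] at h
  rw [h]
  exact Finset.sum_congr rfl fun i _ => scale_massAt hr (stdSimplex.zero_le a i) _

/-- Relations that are compatible with the binary operations are compatible with finite
combinations. -/
theorem rel_combination {R : P → P' → Prop}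
    (hR : ∀ (t : I) ⦃x x' y y'⦄, R x x' → R y y' → R (bary t x y) (bary t x' y'))
    (a : stdSimplex ℝ ι) {p : ι → P} {q : ι → P'} (h : ∀ i, R (p i) (q i)) :
    R (combination a p) (combination a q) := by
  classical
  -- Corresponding partial sums have equal mass, so each further summand enters both with the same
  -- proportion.
  have key : ∀ t : Finset ι,
      (∑ i ∈ t, massAt (a i) (p i) = 0 ∧ ∑ i ∈ t, massAt (a i) (q i) = 0) ∨
      ∃ x y r, ∃ hr : 0 < r, R x y ∧
        ∑ i ∈ t, massAt (a i) (p i) = ((⟨x, r, hr⟩ : MassPoint P) : WithZero (MassPoint P)) ∧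
        ∑ i ∈ t, massAt (a i) (q i) = ((⟨y, r, hr⟩ : MassPoint P') : WithZero (MassPoint P')) := by
    intro t
    induction t using Finset.induction_on with
    | empty => exact Or.inl ⟨rfl, rfl⟩
    | insert i t hi ih =>
      rw [Finset.sum_insert hi, Finset.sum_insert hi]
      have hi0 : 0 ≤ a i := stdSimplex.zero_le a i
      rcases hi0.eq_or_lt with h0 | h0
      · rw [← h0]
        simpa using ih
      · right
        rw [massAt_of_pos h0, massAt_of_pos h0]
        rcases ih with ⟨h1, h2⟩ | ⟨x, y, r, hr, hxy, h1, h2⟩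
        · exact ⟨p i, q i, a i, h0, h i, by rw [h1, add_zero], by rw [h2, add_zero]⟩
        · exact ⟨_, _, _, _, hR (proportion h0 hr) (h i) hxy, by rw [h1]; rfl, by rw [h2]; rfl⟩
  rcases key Finset.univ with ⟨h1, -⟩ | ⟨x, y, r, hr, hxy, h1, h2⟩
  · rw [← massAt_combination, massAt_of_pos one_pos] at h1
    exact absurd h1 WithZero.coe_ne_zero
  · rw [← massAt_combination, massAt_of_pos one_pos, WithZero.coe_inj, MassPoint.mk.injEq] at h1 h2
    rwa [h1.1, h2.1]

theorem IsConvex.combination_mem {A : Set P} (hA : IsConvex A) (a : stdSimplex ℝ ι) {p : ι → P}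
    (h : ∀ i, p i ∈ A) : combination a p ∈ A :=
  rel_combination (R := fun x (_ : P) => x ∈ A) (fun t _ _ _ _ hx hy => hA hx hy t) a (q := p) h

theorem combination_vertex [DecidableEq ι] (i : ι) (p : ι → P) :
    combination (stdSimplex.vertex i) p = p i := by
  refine (eq_combination ?_).symm
  rw [Finset.sum_eq_single i]
  · simp
  · intro j _ hj
    simp [hj]
  · simp

theorem combination_const (a : stdSimplex ℝ ι) (x : P) : combination a (fun _ => x) = x := by
  refine (eq_combination ?_).symm
  rw [← massAt_sum _ (fun i _ => stdSimplex.zero_le a i), stdSimplex.sum_eq_one]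

theorem combination_map (f : ι → κ) (a : stdSimplex ℝ ι) (q : κ → P) :
    combination (stdSimplex.map f a) q = combination a (q ∘ f) := by
  classical
  refine (eq_combination ?_).symm
  rw [massAt_combination, ← Finset.sum_fiberwise _ f]
  refine Finset.sum_congr rfl fun k _ => ?_
  rw [stdSimplex.map_coe, FunOnFinite.linearMap_apply_apply,
    massAt_sum _ fun i _ => stdSimplex.zero_le a i]
  exact (Finset.sum_congr rfl fun i hi => by rw [Function.comp, (Finset.mem_filter.1 hi).2]).symm

/-- The convex combination of two weights. -/
noncomputable def mixWeights (t : I) (a b : stdSimplex ℝ ι) : stdSimplex ℝ ι :=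
  ⟨fun i => t * a i + (1 - t) * b i, convex_stdSimplex ℝ ι a.2 b.2 t.2.1 (by linarith [t.2.2])
    (by ring)⟩

theorem combination_mixWeights (t : I) (a b : stdSimplex ℝ ι) (p : ι → P) :
    combination (mixWeights t a b) p = bary t (combination a p) (combination b p) := by
  refine (eq_combination ?_).symm
  have h1 : (0 : ℝ) ≤ 1 - t := by linarith [t.2.2]
  rw [massAt_bary zero_le_one, mul_one, mul_one, massAt_combination_of_nonneg t.2.1,
    massAt_combination_of_nonneg h1, ← Finset.sum_add_distrib]
  refine Finset.sum_congr rfl fun i _ => ?_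
  rw [← massAt_add (mul_nonneg t.2.1 (stdSimplex.zero_le a i)) (mul_nonneg h1 (stdSimplex.zero_le b i))]
  rfl

end Combination

end BarycentricAlgebra

/-! ### Combinations and convex hulls in the Smyth poweralgebra. -/

namespace BarycentricAlgebra

/-- The weight is `d = c a + (1 - c) b`, checked by comparing masses at `p` and `q` in the cone. -/
theorem bary_bary_bary {P : Type*} [BarycentricAlgebra P] (c a b : I) (p q : P) :
    ∃ d : I, bary c (bary a p q) (bary b p q) = bary d p q := by
  have hc : (0 : ℝ) ≤ 1 - c := by linarith [c.2.2]
  have ha : (0 : ℝ) ≤ 1 - a := by linarith [a.2.2]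
  have hb : (0 : ℝ) ≤ 1 - b := by linarith [b.2.2]
  have hd : (c * a + (1 - c) * b : ℝ) ∈ I := by
    refine ⟨add_nonneg (mul_nonneg c.2.1 a.2.1) (mul_nonneg hc b.2.1), ?_⟩
    nlinarith [c.2.1, a.2.2, b.2.2]
  refine ⟨⟨c * a + (1 - c) * b, hd⟩, massAt_one_injective ?_⟩
  rw [massAt_bary zero_le_one, massAt_bary zero_le_one, mul_one, mul_one, mul_one, mul_one,
    massAt_bary c.2.1, massAt_bary hc, massAt_add (mul_nonneg c.2.1 a.2.1) (mul_nonneg hc b.2.1),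
    show (1 - (c * a + (1 - c) * b) : ℝ) = (1 - a) * c + (1 - b) * (1 - c) by ring,
    massAt_add (mul_nonneg ha c.2.1) (mul_nonneg hb hc), mul_comm (c : ℝ), mul_comm (1 - c : ℝ)]
  abel

namespace Smyth

variable {B : Type*} [TopologicalSpace B] [BarycentricAlgebra B]

theorem le_def {Q R : Smyth B} : Q ≤ R ↔ R.carrier ⊆ Q.carrier := Iff.rfl

/-- A saturated set is the intersection of its open neighborhoods. -/
theorem exists_isOpen_of_notMem {Q : Smyth B} {y : B} (hy : y ∉ Q.carrier) :
    ∃ U, IsOpen U ∧ Q.carrier ⊆ U ∧ y ∉ U := by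
  rw [← Q.saturated, mem_nhdsKer] at hy
  push Not at hy
  exact hy

variable [IsTopological B]

theorem bary_subset_iff {a : I} {Q R : Smyth B} {U : Set B} (hU : IsOpen U) :
    (bary a Q R).carrier ⊆ U ↔ ∀ x ∈ Q.carrier, ∀ y ∈ R.carrier, bary a x y ∈ U := by
  change nhdsKer _ ⊆ U ↔ _
  rw [hU.nhdsKer_subset, image2_subset_iff]

theorem bary_mem {a : I} {Q R : Smyth B} {x y : B} (hx : x ∈ Q.carrier) (hy : y ∈ R.carrier) :
    bary a x y ∈ (bary a Q R).carrier :=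
  mem_add.2 ⟨x, hx, y, hy, specializes_rfl⟩

theorem bary_mono (a : I) {Q Q' R R' : Smyth B} (h : Q ≤ Q') (h' : R ≤ R') :
    bary a Q R ≤ bary a Q' R' := by
  intro z hz
  obtain ⟨x, hx, y, hy, hxy⟩ := mem_add.1 hz
  exact mem_add.2 ⟨x, h hx, y, h' hy, hxy⟩

/-- The operations of the Smyth poweralgebra are jointly continuous for the upper Vietoris
topology. -/
theorem exists_isOpen_bary_subset {a : I} {Q R : Smyth B} {U : Set B} (hU : IsOpen U)
    (h : (bary a Q R).carrier ⊆ U) :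
    ∃ V ∈ 𝓝 a, ∃ W, IsOpen W ∧ Q.carrier ⊆ W ∧ ∃ W', IsOpen W' ∧ R.carrier ⊆ W' ∧
      ∀ b ∈ V, ∀ x ∈ W, ∀ y ∈ W', bary b x y ∈ U := by
  have hopen : IsOpen {p : I × B × B | bary p.1 p.2.1 p.2.2 ∈ U} :=
    hU.preimage (continuous_bary continuous_fst (continuous_fst.comp continuous_snd)
      (continuous_snd.comp continuous_snd))
  obtain ⟨V, N, hV, hN, haV, hQN, hVN⟩ := generalized_tube_lemma (isCompact_singleton (x := a))
    (Q.isCompact.prod R.isCompact) hopen (by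
      rintro ⟨b, x, y⟩ ⟨hb, hx, hy⟩
      rw [mem_singleton_iff] at hb
      subst hb
      exact (bary_subset_iff hU).1 h x hx y hy)
  obtain ⟨W, W', hW, hW', hQW, hRW', hWN⟩ :=
    generalized_tube_lemma Q.isCompact R.isCompact hN hQN
  exact ⟨V, hV.mem_nhds (haV rfl), W, hW, hQW, W', hW', hRW', fun b hb x hx y hy =>
    hVN (mk_mem_prod hb (hWN (mk_mem_prod hx hy)))⟩

/-- The union of a convex family of elements that is indexed continuously by a compact space. -/
theorem exists_carrier_eq_iUnion {T : Type*} [TopologicalSpace T] [CompactSpace T] [Nonempty T]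
    (Q : T → Smyth B) (hQ : ∀ U, IsOpen U → IsOpen {t | (Q t).carrier ⊆ U})
    (hcvx : ∀ c s t, ∃ u, bary c (Q s) (Q t) = Q u) :
    ∃ E : Smyth B, E.carrier = ⋃ t, (Q t).carrier := by
  refine ⟨⟨⋃ t, (Q t).carrier, ?_, ?_, ?_, ?_⟩, rfl⟩
  · exact nonempty_iUnion.2 ⟨Classical.arbitrary T, (Q _).nonempty⟩
  · intro x hx y hy c
    obtain ⟨s, hs⟩ := mem_iUnion.1 hx
    obtain ⟨t, ht⟩ := mem_iUnion.1 hy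
    obtain ⟨u, hu⟩ := hcvx c s t
    exact mem_iUnion.2 ⟨u, hu ▸ bary_mem hs ht⟩
  · refine isCompact_of_finite_subcover fun U hU hcov => ?_
    have hfin : ∀ t, ∃ f : Finset _, (Q t).carrier ⊆ ⋃ i ∈ f, U i := fun t =>
      (Q t).isCompact.elim_finite_subcover U hU ((subset_iUnion _ t).trans hcov)
    choose f hf using hfin
    -- A finite subfamily that covers `Q t` also covers `Q s` for `s` near `t`, so compactness of
    -- `T` leaves finitely many subfamilies.
    obtain ⟨F, hF⟩ := isCompact_univ.elim_finite_subcover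
      (fun t => {s | (Q s).carrier ⊆ ⋃ i ∈ f t, U i})
      (fun t => hQ _ (isOpen_biUnion fun i _ => hU i)) (fun t _ => mem_iUnion.2 ⟨t, hf t⟩)
    classical
    refine ⟨F.biUnion f, iUnion_subset fun s => ?_⟩
    obtain ⟨t, ht, hs⟩ := mem_iUnion₂.1 (hF (mem_univ s))
    refine hs.trans (iUnion₂_subset fun i hi => ?_)
    exact subset_biUnion_of_mem (u := U) (Finset.mem_biUnion.2 ⟨t, ht, hi⟩)
  · rw [nhdsKer_iUnion]
    exact iUnion_congr fun t => (Q t).saturated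

/-- The union of all `bary a Q R` works; its end points `a = 1` and `a = 0` are `Q` and `R`. -/
theorem exists_le_le (Q R : Smyth B) : ∃ C : Smyth B, C ≤ Q ∧ C ≤ R := by
  obtain ⟨C, hC⟩ := exists_carrier_eq_iUnion (fun a : I => bary a Q R) (by
    intro U hU
    refine isOpen_iff_mem_nhds.2 fun a ha => ?_
    obtain ⟨V, hV, W, -, hQW, W', -, hRW', h⟩ := exists_isOpen_bary_subset hU ha
    filter_upwards [hV] with b hb
    exact (bary_subset_iff hU).2 fun x hx y hy => h b hb x (hQW hx) y (hRW' hy))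
    (fun c a b => bary_bary_bary c a b Q R)
  refine ⟨C, ?_, ?_⟩
  · rw [le_def, hC]
    exact (subset_iUnion (fun a : I => (bary a Q R).carrier) 1).trans' (by rw [bary_one])
  · rw [le_def, hC]
    exact (subset_iUnion (fun a : I => (bary a Q R).carrier) 0).trans' (by rw [bary_zero])

theorem exists_forall_le {ι : Type*} [Finite ι] [Nonempty ι] (K : ι → Smyth B) :
    ∃ C : Smyth B, ∀ i, C ≤ K i := by
  have : IsCodirectedOrder (Smyth B) := ⟨exists_le_le⟩
  have : Nonempty (Smyth B) := ⟨K (Classical.arbitrary ι)⟩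
  obtain ⟨C, hC⟩ := Set.Finite.bddBelow (finite_range K)
  exact ⟨C, fun i => hC (mem_range_self i)⟩

variable {ι : Type*} [Fintype ι]

theorem combination_mono (a : stdSimplex ℝ ι) {K L : ι → Smyth B} (h : ∀ i, K i ≤ L i) :
    combination a K ≤ combination a L :=
  rel_combination (R := fun Q R : Smyth B => Q ≤ R) (fun t _ _ _ _ => bary_mono t) a h

/-- Weights `b` near `a` split as `t a + (1 - t) c` with `t < 1` fixed close to `1`. The part with
weights `c` is uncontrolled, but lies above a common lower bound `C` of the `K i`; continuity at `t
= 1` of `bary t (combination a K) C` then suffices. -/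
theorem isOpen_setOf_combination_subset (K : ι → Smyth B) {U : Set B} (hU : IsOpen U) :
    IsOpen {a : stdSimplex ℝ ι | (combination a K).carrier ⊆ U} := by
  refine isOpen_iff_mem_nhds.2 fun a ha => ?_
  have : Nonempty ι := by
    by_contra hne
    rw [not_nonempty_iff] at hne
    simpa using stdSimplex.sum_eq_one a
  obtain ⟨C, hC⟩ := exists_forall_le K
  have hCb : ∀ b : stdSimplex ℝ ι, C ≤ combination b K := fun b => by
    have := combination_mono b hC
    rwa [combination_const] at this
  obtain ⟨V, hV, W, -, hQW, W', -, hRW', h⟩ := exists_isOpen_bary_subset (a := 1)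
    (Q := combination a K) (R := C) hU (by rwa [bary_one])
  obtain ⟨t, htV, ht1⟩ : ∃ t ∈ V, t < 1 := by
    have hne : (𝓝[<] (1 : I)).NeBot := nhdsLT_neBot_of_exists_lt ⟨0, by simp⟩
    have hmem : V ∩ Iio 1 ∈ 𝓝[<] (1 : I) :=
      Filter.inter_mem (mem_nhdsWithin_of_mem_nhds hV) self_mem_nhdsWithin
    exact Filter.nonempty_of_mem hmem
  have ht1' : (0 : ℝ) < 1 - t := sub_pos.2 ht1
  have hnear : ∀ᶠ b : stdSimplex ℝ ι in 𝓝 a, ∀ i, (t : ℝ) * a i ≤ b i := by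
    refine Filter.eventually_all.2 fun i => ?_
    rcases (stdSimplex.zero_le a i).eq_or_lt with h0 | h0
    · rw [← h0, mul_zero]
      exact Filter.Eventually.of_forall fun b => stdSimplex.zero_le b i
    · have hcont : Continuous fun b : stdSimplex ℝ ι => b i :=
        (continuous_apply i).comp continuous_subtype_val
      have hlt : (t : ℝ) * a i < a i := by nlinarith
      exact (hcont.continuousAt.eventually (lt_mem_nhds hlt)).mono fun b hb => hb.le
  filter_upwards [hnear] with b hb
  let c : stdSimplex ℝ ι := ⟨fun i => (b i - t * a i) / (1 - t), fun i =>
    div_nonneg (sub_nonneg.2 (hb i)) ht1'.le, by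
      rw [← Finset.sum_div, Finset.sum_sub_distrib, ← Finset.mul_sum, stdSimplex.sum_eq_one,
        stdSimplex.sum_eq_one, mul_one, div_self ht1'.ne']⟩
  have hbc : b = mixWeights t a c := by
    ext i
    change b i = t * a i + (1 - t) * ((b i - t * a i) / (1 - t))
    field_simp
    ring
  change (combination b K).carrier ⊆ U
  rw [hbc, combination_mixWeights]
  exact Subset.trans (bary_mono t le_rfl (hCb c))
    ((bary_subset_iff hU).2 fun x hx y hy => h t htV x (hQW hx) y (hRW' hy))

/-- The convex hull of a finite union of convex compact saturated sets. -/
theorem exists_carrier_eq_iUnion_combination [Nonempty ι] (K : ι → Smyth B) :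
    ∃ E : Smyth B, E.carrier = ⋃ a, (combination a K).carrier :=
  exists_carrier_eq_iUnion (fun a => combination a K)
    (fun _ => isOpen_setOf_combination_subset K)
    (fun c a b => ⟨mixWeights c a b, (combination_mixWeights c a b K).symm⟩)

end Smyth

end BarycentricAlgebra

/-! ### Inverse limits and convex compact neighborhoods. -/

/-- Inverse sequences of non-empty compact Hausdorff spaces have non-empty limits. -/
theorem exists_thread_of_compactSpace {X : ℕ → Type*} [∀ n, TopologicalSpace (X n)]
    [∀ n, CompactSpace (X n)] [∀ n, T2Space (X n)] [∀ n, Nonempty (X n)]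
    (f : ∀ n, X (n + 1) → X n) (hf : ∀ n, Continuous (f n)) :
    ∃ b : ∀ n, X n, ∀ n, f n (b (n + 1)) = b n := by
  have hext : ∀ N (x : X N), ∃ b : ∀ n, X n, b N = x ∧ ∀ n < N, f n (b (n + 1)) = b n := by
    intro N
    induction N with
    | zero =>
      intro x
      exact ⟨Function.update (fun n => Classical.arbitrary (X n)) 0 x, by simp, by simp⟩
    | succ N ih =>
      intro x
      obtain ⟨b, hb, hbn⟩ := ih (f N x)
      refine ⟨Function.update b (N + 1) x, by simp, fun n hn => ?_⟩
      rw [Function.update_of_ne hn.ne]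
      rcases (Nat.lt_succ_iff.1 hn).eq_or_lt with rfl | hlt
      · rw [Function.update_self, hb]
      · rw [Function.update_of_ne (by omega), hbn n hlt]
  obtain ⟨b, hb⟩ := IsCompact.nonempty_iInter_of_sequence_nonempty_isCompact_isClosed
    (fun N => {b : ∀ n, X n | ∀ n < N, f n (b (n + 1)) = b n})
    (fun N b hb n hn => hb n (hn.trans (Nat.lt_succ_self N)))
    (fun N => by
      obtain ⟨b, -, hb⟩ := hext N (Classical.arbitrary _)
      exact ⟨b, hb⟩)
    (by simp [isCompact_univ])
    (fun N => by
      simp only [ofPred_forall]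
      exact isClosed_iInter fun n => isClosed_iInter fun _ =>
        isClosed_eq ((hf n).comp (continuous_apply _)) (continuous_apply _))
  exact ⟨b, fun n => mem_iInter.1 hb (n + 1) n (Nat.lt_succ_self n)⟩

namespace BarycentricAlgebra

namespace Smyth

variable {B : Type*} [TopologicalSpace B] [BarycentricAlgebra B]

/-- Directed suprema are filtered intersections. -/
theorem exists_carrier_eq_biInter [QuasiSober B] {D : Set (Smyth B)} (hne : D.Nonempty)
    (hD : DirectedOn (· ≤ ·) D) :
    ∃ Q : Smyth B, Q.carrier = ⋂ Q' ∈ D, Q'.carrier ∧ IsLUB D Q := by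
  have := hne.to_subtype
  have hdir : Directed (· ⊇ ·) fun Q : D => Q.1.carrier := hD.directed_val
  have hc : ∀ Q : D, IsCompact Q.1.carrier := fun Q => Q.1.isCompact
  have hs : ∀ Q : D, nhdsKer Q.1.carrier = Q.1.carrier := fun Q => Q.1.saturated
  refine ⟨⟨⋂ Q : D, Q.1.carrier, ?_, ?_, isCompact_iInter_of_quasiSober hdir hc hs,
    nhdsKer_iInter_eq hs⟩, ?_, ?_⟩
  · by_contra hemp
    obtain ⟨Q, hQ⟩ := exists_subset_of_iInter_subset_of_quasiSober hdir hc hs isOpen_empty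
      (not_nonempty_iff_eq_empty.1 hemp).subset
    exact Q.1.nonempty.ne_empty (subset_empty_iff.1 hQ)
  · intro x hx y hy a
    exact mem_iInter.2 fun Q => Q.1.isConvex (mem_iInter.1 hx Q) (mem_iInter.1 hy Q) a
  · exact iInter_subtype _ _
  · exact ⟨fun Q hQ => iInter_subset (fun Q : D => Q.1.carrier) ⟨Q, hQ⟩,
      fun R hR => subset_iInter fun Q => hR Q.2⟩

/-- Well-filteredness in order-theoretic form: by uniqueness of suprema, `Q` is the intersection of
`D`. -/
theorem exists_subset_of_isLUB [QuasiSober B] {D : Set (Smyth B)} (hne : D.Nonempty)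
    (hD : DirectedOn (· ≤ ·) D) {Q : Smyth B} (hQ : IsLUB D Q) {U : Set B} (hU : IsOpen U)
    (h : Q.carrier ⊆ U) : ∃ R ∈ D, R.carrier ⊆ U := by
  obtain ⟨Q', hQ', hlub⟩ := exists_carrier_eq_biInter hne hD
  have := hne.to_subtype
  rw [hQ.unique hlub, hQ', biInter_eq_iInter] at h
  obtain ⟨R, hR⟩ := exists_subset_of_iInter_subset_of_quasiSober hD.directed_val
    (fun Q : D => Q.1.isCompact) (fun Q : D => Q.1.saturated) hU h
  exact ⟨R.1, R.2, hR⟩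

variable [IsConvenient B]

theorem exists_mem_interior_subset {x : B} {N : Set B} (hN : N ∈ 𝓝 x) :
    ∃ K : Smyth B, x ∈ interior K.carrier ∧ K.carrier ⊆ N := by
  obtain ⟨U, hUN, hU, hxU⟩ := mem_nhds_iff.1 hN
  obtain ⟨K, hK, hcvx, hc, hKU⟩ := IsConvenient.locallyConvexCompact x U (hU.mem_nhds hxU)
  refine ⟨⟨nhdsKer K, ⟨x, subset_nhdsKer (mem_of_mem_nhds hK)⟩, ?_, hc.nhdsKer,
    nhdsKer_nhdsKer K⟩, ?_, ?_⟩
  · intro y hy z hz a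
    rw [mem_nhdsKer_iff_specializes] at hy hz ⊢
    obtain ⟨y', hy', hyy⟩ := hy
    obtain ⟨z', hz', hzz⟩ := hz
    exact ⟨_, hcvx hy' hz' a, specializes_bary a hyy hzz⟩
  · exact interior_mono subset_nhdsKer (mem_interior_iff_mem_nhds.2 hK)
  · exact (hU.nhdsKer_subset.2 hKU).trans hUN

theorem exists_finset_cover (Q : Smyth B) {N : B → Set B} (hN : ∀ x ∈ Q.carrier, N x ∈ 𝓝 x) :
    ∃ 𝒦 : Finset (Smyth B), Q.carrier ⊆ ⋃ K ∈ 𝒦, interior K.carrier ∧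
      ∀ K ∈ 𝒦, ∃ x ∈ Q.carrier, K.carrier ⊆ N x := by
  classical
  choose K hxK hKN using fun x : Q.carrier => exists_mem_interior_subset (hN x x.2)
  obtain ⟨t, ht⟩ := Q.isCompact.elim_finite_subcover (fun x => interior (K x).carrier)
    (fun x => isOpen_interior) (fun x hx => mem_iUnion.2 ⟨⟨x, hx⟩, hxK ⟨x, hx⟩⟩)
  refine ⟨t.image K, ?_, ?_⟩
  · rwa [Finset.set_biUnion_finset_image]
  · intro L hL
    obtain ⟨x, -, rfl⟩ := Finset.mem_image.1 hL
    exact ⟨x, x.2, hKN x⟩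

/-- Open neighborhoods of `Q`, with finite covers of `Q` by interiors of convex compact subsets. -/
structure CoverStage (Q : Smyth B) where
  nbhd : Set B
  cover : Finset (Smyth B)
  isOpen_nbhd : IsOpen nbhd
  subset_nbhd : Q.carrier ⊆ nbhd
  cover_subset : ∀ K ∈ cover, K.carrier ⊆ nbhd
  subset_cover : Q.carrier ⊆ ⋃ K ∈ cover, interior K.carrier

/-- The refinement relation of stages: segments between points of the smaller neighborhood stay in
the larger one, and each element of the finer cover is contained in one of the coarser cover. -/
structure CoverStage.Refines {Q : Smyth B} (s' s : CoverStage Q) : Prop where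
  nbhd_subset : s'.nbhd ⊆ ⋃ K ∈ s.cover, K.carrier
  bary_mem : ∀ a : I, ∀ x ∈ s'.nbhd, ∀ y ∈ s'.nbhd, bary a x y ∈ s.nbhd
  exists_le : ∀ L ∈ s'.cover, ∃ K ∈ s.cover, K ≤ L

/-- Convexity sends the compact set `I × Q × Q` into the neighborhood, so the tube lemma yields a
smaller one whose segments stay inside. The new cover is chosen subordinate to the interiors of the
old one. -/
theorem CoverStage.exists_refines {Q : Smyth B} (s : CoverStage Q) : ∃ s', Refines s' s := by
  have hopen : IsOpen {p : I × B × B | bary p.1 p.2.1 p.2.2 ∈ s.nbhd} :=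
    s.isOpen_nbhd.preimage (continuous_bary continuous_fst (continuous_fst.comp continuous_snd)
      (continuous_snd.comp continuous_snd))
  obtain ⟨V, N, -, hN, hV, hQN, hVN⟩ := generalized_tube_lemma (isCompact_univ (X := I))
    (Q.isCompact.prod Q.isCompact) hopen (by
      rintro ⟨b, x, y⟩ ⟨-, hx, hy⟩
      exact s.subset_nbhd (Q.isConvex hx hy b))
  obtain ⟨W, W', hW, hW', hQW, hQW', hWN⟩ :=
    generalized_tube_lemma Q.isCompact Q.isCompact hN hQN
  set V' : Set B := W ∩ W' ∩ ⋃ K ∈ s.cover, interior K.carrier with hV'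
  have hV'o : IsOpen V' :=
    (hW.inter hW').inter (isOpen_biUnion fun _ _ => isOpen_interior)
  have hQV' : Q.carrier ⊆ V' := subset_inter (subset_inter hQW hQW') s.subset_cover
  have hpt : ∀ x ∈ Q.carrier, ∃ K ∈ s.cover, x ∈ interior K.carrier := fun x hx => by
    simpa using s.subset_cover hx
  have : Nonempty (Smyth B) := ⟨Q⟩
  choose! K hK hxK using hpt
  obtain ⟨𝒦, hQ𝒦, h𝒦⟩ := exists_finset_cover Q (N := fun x => V' ∩ interior (K x).carrier)
    (fun x hx => (hV'o.inter isOpen_interior).mem_nhds ⟨hQV' hx, hxK x hx⟩)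
  refine ⟨⟨V', 𝒦, hV'o, hQV', fun L hL => ?_, hQ𝒦⟩, ?_, ?_, ?_⟩
  · obtain ⟨x, -, hx⟩ := h𝒦 L hL
    exact hx.trans inter_subset_left
  · exact inter_subset_right.trans (iUnion₂_mono fun K _ => interior_subset)
  · exact fun a x hx y hy => hVN (mk_mem_prod (hV (mem_univ a))
      (hWN (mk_mem_prod hx.1.1 hy.1.2)))
  · intro L hL
    obtain ⟨x, hxQ, hx⟩ := h𝒦 L hL
    exact ⟨K x, hK x hxQ, (hx.trans inter_subset_right).trans interior_subset⟩

theorem CoverStage.exists_seq (Q : Smyth B) {U : Set B} (hU : IsOpen U) (hQU : Q.carrier ⊆ U) :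
    ∃ s : ℕ → CoverStage Q, (s 0).nbhd = U ∧ ∀ n, Refines (s (n + 1)) (s n) := by
  obtain ⟨𝒦, hQ𝒦, h𝒦⟩ := exists_finset_cover Q (N := fun _ => U)
    (fun x hx => hU.mem_nhds (hQU hx))
  choose f hf using fun s : CoverStage Q => s.exists_refines
  refine ⟨fun n => f^[n] ⟨U, 𝒦, hU, hQU, fun K hK => ?_, hQ𝒦⟩, rfl, fun n => ?_⟩
  · obtain ⟨_, -, h⟩ := h𝒦 K hK
    exact h
  · simp only [Function.iterate_succ_apply']
    exact hf _

/-- The intersection of a refining sequence of covers is convex and compact. -/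
theorem CoverStage.exists_inter {Q : Smyth B} (s : ℕ → CoverStage Q)
    (hs : ∀ n, Refines (s (n + 1)) (s n)) :
    ∃ A : Smyth B, A.carrier ⊆ (s 0).nbhd ∧
      ∀ W, IsOpen W → A.carrier ⊆ W → ∃ n, ∀ K ∈ (s n).cover, K.carrier ⊆ W := by
  set T : ℕ → Set B := fun n => ⋃ K ∈ (s n).cover, K.carrier with hT
  have hTs : ∀ n, T n ⊆ (s n).nbhd := fun n => iUnion₂_subset fun K hK => (s n).cover_subset K hK
  have hanti : Antitone T := antitone_nat_of_succ_le fun n => (hTs (n + 1)).trans (hs n).nbhd_subset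
  have hdir : Directed (· ⊇ ·) T := hanti.directed_ge
  have hTc : ∀ n, IsCompact (T n) := fun n => (s n).cover.isCompact_biUnion fun K _ => K.isCompact
  have hTk : ∀ n, nhdsKer (T n) = T n := fun n => by
    simp only [hT, nhdsKer_iUnion, saturated]
  have hQT : ∀ n, Q.carrier ⊆ T n := fun n =>
    (s n).subset_cover.trans (iUnion₂_mono fun K _ => interior_subset)
  refine ⟨⟨⋂ n, T n, Q.nonempty.mono (subset_iInter hQT), ?_,
    isCompact_iInter_of_quasiSober hdir hTc hTk, nhdsKer_iInter_eq hTk⟩,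
    (iInter_subset T 0).trans (hTs 0), fun W hW hAW => ?_⟩
  · intro x hx y hy a
    -- Two stages are lost: end points at stage `n + 2` give a segment in the neighborhood of stage
    -- `n + 1`, which lies in `T n`.
    refine mem_iInter.2 fun n => (hs n).nbhd_subset ((hs (n + 1)).bary_mem a x ?_ y ?_)
    · exact hTs _ (mem_iInter.1 hx _)
    · exact hTs _ (mem_iInter.1 hy _)
  · obtain ⟨n, hn⟩ := exists_subset_of_iInter_subset_of_quasiSober hdir hTc hTk hW hAW
    exact ⟨n, fun K hK => (subset_biUnion_of_mem (u := fun K : Smyth B => K.carrier) hK).trans hn⟩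

/-- Convex compact saturated sets have neighborhood bases of convex compact saturated sets. -/
theorem exists_subset_interior (Q : Smyth B) {U : Set B} (hU : IsOpen U) (hQU : Q.carrier ⊆ U) :
    ∃ Q' : Smyth B, Q.carrier ⊆ interior Q'.carrier ∧ Q'.carrier ⊆ U := by
  classical
  by_contra! hcon
  obtain ⟨s, hs0, hs⟩ := CoverStage.exists_seq Q hU hQU
  obtain ⟨A, hAU, hA⟩ := CoverStage.exists_inter s hs
  rw [hs0] at hAU
  have hpar : ∀ n, ∃ f : (s (n + 1)).cover → (s n).cover, ∀ L, (f L).1 ≤ L.1 := fun n => by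
    choose f hf hle using (hs n).exists_le
    exact ⟨fun L => ⟨f L L.2, hf L L.2⟩, fun L => hle L L.2⟩
  choose f hf using hpar
  let D : ∀ n, stdSimplex ℝ (s n).cover → Smyth B := fun n a => combination a (fun K => K.1)
  have hDf : ∀ n a, D n (stdSimplex.map (f n) a) ≤ D (n + 1) a := fun n a => by
    change combination _ _ ≤ _
    rw [combination_map]
    exact combination_mono a (hf n)
  -- The weights whose combination leaves `U`: compact by semicontinuity, and non-empty because
  -- otherwise the convex hull of the cover would be the neighborhood sought.
  let X : ℕ → Type _ := fun n => {a : stdSimplex ℝ (s n).cover // ¬ (D n a).carrier ⊆ U}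
  have : ∀ n, CompactSpace (X n) := fun n =>
    isCompact_iff_compactSpace.1 (isOpen_setOf_combination_subset _ hU).isClosed_compl.isCompact
  have : ∀ n, Nonempty (X n) := fun n => by
    have hne : Nonempty (s n).cover := by
      obtain ⟨x, hx⟩ := Q.nonempty
      obtain ⟨K, hK, -⟩ := mem_iUnion₂.1 ((s n).subset_cover hx)
      exact ⟨⟨K, hK⟩⟩
    obtain ⟨E, hE⟩ := exists_carrier_eq_iUnion_combination fun K : (s n).cover => K.1
    have hKE : ∀ K ∈ (s n).cover, K.carrier ⊆ E.carrier := fun K hK => by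
      rw [hE]
      refine Subset.trans ?_ (subset_iUnion _ (stdSimplex.vertex ⟨K, hK⟩))
      rw [combination_vertex]
    have hEU := hcon E ((s n).subset_cover.trans
      (iUnion₂_subset fun K hK => interior_mono (hKE K hK)))
    rw [hE, iUnion_subset_iff] at hEU
    push Not at hEU
    obtain ⟨a, ha⟩ := hEU
    exact ⟨⟨a, ha⟩⟩
  obtain ⟨b, hb⟩ := exists_thread_of_compactSpace (X := X)
    (fun n a => ⟨stdSimplex.map (f n) a.1, fun h => a.2 (Subset.trans (hDf n a.1) h)⟩)
    (fun n => ((stdSimplex.continuous_map (f n)).comp continuous_subtype_val).subtype_mk _)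
  have hmono : Monotone fun n => D n (b n).1 := monotone_nat_of_le_succ fun n => by
    have := hDf n (b (n + 1)).1
    rwa [show stdSimplex.map (f n) (b (n + 1)).1 = (b n).1 from congrArg Subtype.val (hb n)] at this
  obtain ⟨y, hy, hyU⟩ : ∃ y ∈ ⋂ n, (D n (b n).1).carrier, y ∉ U := by
    by_contra! hall
    obtain ⟨n, hn⟩ := exists_subset_of_iInter_subset_of_quasiSober
      (K := fun n => (D n (b n).1).carrier) (fun i j => ⟨max i j, hmono (le_max_left i j),
        hmono (le_max_right i j)⟩) (fun n => (D n (b n).1).isCompact)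
      (fun n => (D n (b n).1).saturated) hU hall
    exact (b n).2 hn
  -- The open half-space `1 < Λ` contains `A`, hence a whole cover, hence by convexity its
  -- combination `D n (b n)`, which contains `y`.
  obtain ⟨Λ, ha, hc, hyΛ, hΛ⟩ :=
    IsConvenient.linearlySeparated.exists_affine_lt A fun h => hyU (hAU h)
  obtain ⟨n, hn⟩ := hA {x | 1 < Λ x} (hc.isOpen_preimage 1) hΛ
  have hcvx : IsConvex {R : Smyth B | R.carrier ⊆ {x | 1 < Λ x}} := fun R hR R' hR' a =>
    (bary_subset_iff (hc.isOpen_preimage 1)).2 fun x hx y hy =>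
      ha.isConvex_lt 1 (hR hx) (hR' hy) a
  have hD : (D n (b n).1).carrier ⊆ {x | 1 < Λ x} :=
    hcvx.combination_mem (b n).1 fun K => hn K.1 K.2
  exact absurd (hD (mem_iInter.1 hy n)) (not_lt.2 hyΛ)

end Smyth

end BarycentricAlgebra

/-! ### The Scott topology and the transfer of convenience. -/

namespace BarycentricAlgebra

namespace Smyth

variable {B : Type*} [TopologicalSpace B] [BarycentricAlgebra B]

instance : Topology.IsScott (Smyth B) univ := ⟨rfl⟩

theorem specializes_iff_le {Q R : Smyth B} : R ⤳ Q ↔ Q ≤ R := by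
  rw [specializes_iff_mem_closure, Topology.IsScott.closure_singleton, mem_Iic]

/-- The extension of a functional to the Smyth poweralgebra. -/
noncomputable def lowerValue (Λ : B → ℝ≥0∞) (Q : Smyth B) : ℝ≥0∞ := ⨅ x ∈ Q.carrier, Λ x

theorem exists_lowerValue_eq {Λ : B → ℝ≥0∞} (hΛ : LowerSemicontinuous Λ) (Q : Smyth B) :
    ∃ x ∈ Q.carrier, lowerValue Λ Q = Λ x := by
  obtain ⟨x, hx, hmin⟩ :=
    LowerSemicontinuousOn.exists_isMinOn Q.nonempty Q.isCompact (hΛ.lowerSemicontinuousOn _)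
  exact ⟨x, hx, le_antisymm (iInf₂_le x hx) (le_iInf₂ fun y hy => hmin hy)⟩

/-- The strict inequality survives the infimum because the infimum is attained. -/
theorem lt_lowerValue_iff {Λ : B → ℝ≥0∞} (hΛ : LowerSemicontinuous Λ) {Q : Smyth B} {r : ℝ≥0∞} :
    r < lowerValue Λ Q ↔ Q.carrier ⊆ {x | r < Λ x} := by
  obtain ⟨x, hx, hQ⟩ := exists_lowerValue_eq hΛ Q
  exact ⟨fun h y hy => h.trans_le (iInf₂_le y hy), fun h => hQ ▸ h hx⟩

variable [IsConvenient B]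

theorem wayBelow_of_subset_interior {Q' Q : Smyth B} (h : Q.carrier ⊆ interior Q'.carrier) :
    WayBelow Q' Q := by
  intro D hne hD s hs hQs
  obtain ⟨R, hR, hRQ⟩ := exists_subset_of_isLUB hne hD hs isOpen_interior (Subset.trans hQs h)
  exact ⟨R, hR, hRQ.trans interior_subset⟩

theorem setOf_subset_interior_nonempty (Q : Smyth B) :
    {Q' : Smyth B | Q.carrier ⊆ interior Q'.carrier}.Nonempty := by
  obtain ⟨Q', h, -⟩ := exists_subset_interior Q isOpen_univ (subset_univ _)
  exact ⟨Q', h⟩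

theorem directedOn_setOf_subset_interior (Q : Smyth B) :
    DirectedOn (· ≤ ·) {Q' : Smyth B | Q.carrier ⊆ interior Q'.carrier} := by
  intro Q₁ h₁ Q₂ h₂
  obtain ⟨Q', h, hQ'⟩ := exists_subset_interior Q (isOpen_interior.inter isOpen_interior)
    (subset_inter h₁ h₂)
  exact ⟨Q', h, (hQ'.trans inter_subset_left).trans interior_subset,
    (hQ'.trans inter_subset_right).trans interior_subset⟩

theorem isLUB_setOf_subset_interior (Q : Smyth B) :
    IsLUB {Q' : Smyth B | Q.carrier ⊆ interior Q'.carrier} Q := by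
  refine ⟨fun Q' h => Subset.trans (id h : Q.carrier ⊆ interior Q'.carrier) interior_subset, fun R hR y hy => ?_⟩
  by_contra hyQ
  obtain ⟨U, hU, hQU, hyU⟩ := exists_isOpen_of_notMem hyQ
  obtain ⟨Q', h, hQ'⟩ := exists_subset_interior Q hU hQU
  exact hyU (hQ' (hR h hy))

/-- The neighborhoods `Q'` of `Q` are cofinal among the elements way below `Q`, so directedness and
suprema can be computed with them. -/
theorem exists_le_of_wayBelow {Q R : Smyth B} (h : WayBelow R Q) :
    ∃ Q' : Smyth B, Q.carrier ⊆ interior Q'.carrier ∧ R ≤ Q' :=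
  h _ (setOf_subset_interior_nonempty Q) (directedOn_setOf_subset_interior Q) Q
    (isLUB_setOf_subset_interior Q) le_rfl

variable (B) in
theorem isContinuousPoset : IsContinuousPoset (Smyth B) := by
  intro Q
  refine ⟨?_, ?_, ?_, ?_⟩
  · obtain ⟨Q', h⟩ := setOf_subset_interior_nonempty Q
    exact ⟨Q', wayBelow_of_subset_interior h⟩
  · intro R₁ h₁ R₂ h₂
    obtain ⟨Q₁, hQ₁, hR₁⟩ := exists_le_of_wayBelow h₁
    obtain ⟨Q₂, hQ₂, hR₂⟩ := exists_le_of_wayBelow h₂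
    obtain ⟨Q', h, hQ'₁, hQ'₂⟩ := directedOn_setOf_subset_interior Q Q₁ hQ₁ Q₂ hQ₂
    exact ⟨Q', wayBelow_of_subset_interior h, hR₁.trans hQ'₁, hR₂.trans hQ'₂⟩
  · intro R hR
    obtain ⟨Q', h, hR'⟩ := exists_le_of_wayBelow hR
    exact hR'.trans ((isLUB_setOf_subset_interior Q).1 h)
  · exact fun R hR => (isLUB_setOf_subset_interior Q).2 fun Q' h =>
      hR (wayBelow_of_subset_interior h)

theorem isOpen_setOf_subset {U : Set B} (hU : IsOpen U) :
    IsOpen {Q : Smyth B | Q.carrier ⊆ U} := by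
  rw [Topology.IsScott.isOpen_iff_isUpperSet_and_dirSupInaccOn (D := univ)]
  refine ⟨fun Q R h hQ => Subset.trans h hQ, fun D _ hne hD Q hQ hQU => ?_⟩
  obtain ⟨R, hR, hRU⟩ := exists_subset_of_isLUB hne hD hQ hU hQU
  exact ⟨R, hR, hRU⟩

/-- Since `Q` is the directed supremum of its neighborhoods, some such `Q'` is in `S`; take `U` to
be its interior. This is the harder half of Scott = upper Vietoris. -/
theorem exists_isOpen_of_mem {S : Set (Smyth B)} (hS : IsOpen S) {Q : Smyth B} (hQ : Q ∈ S) :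
    ∃ U, IsOpen U ∧ Q.carrier ⊆ U ∧ ∀ R : Smyth B, R.carrier ⊆ U → R ∈ S := by
  rw [Topology.IsScott.isOpen_iff_isUpperSet_and_dirSupInaccOn (D := univ)] at hS
  obtain ⟨Q', h, hQ'⟩ := hS.2 (mem_univ _) (setOf_subset_interior_nonempty Q)
    (directedOn_setOf_subset_interior Q) (isLUB_setOf_subset_interior Q) hQ
  exact ⟨_, isOpen_interior, h, fun R hR => hS.1 (hR.trans interior_subset) hQ'⟩

variable (B) in
theorem upperVietoris_eq_scott : upperVietoris B = Topology.scott (Smyth B) univ := by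
  refine le_antisymm (fun S hS => ?_) (le_generateFrom ?_)
  · refine (@isOpen_iff_forall_mem_open _ (upperVietoris B) S).2 fun Q hQ => ?_
    obtain ⟨U, hU, hQU, h⟩ := exists_isOpen_of_mem hS hQ
    exact ⟨{R | R.carrier ⊆ U}, fun R hR => h R hR,
      TopologicalSpace.isOpen_generateFrom_of_mem ⟨U, hU, rfl⟩, hQU⟩
  · rintro _ ⟨U, hU, rfl⟩
    exact isOpen_setOf_subset hU

instance : IsTopological (Smyth B) where
  continuous_bary := by
    refine continuous_def.2 fun S hS => isOpen_iff_mem_nhds.2 ?_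
    rintro ⟨Q, a, R⟩ hQR
    obtain ⟨U, hU, hQU, hUS⟩ := exists_isOpen_of_mem hS hQR
    obtain ⟨V, hV, W, hW, hQW, W', hW', hRW', h⟩ := exists_isOpen_bary_subset hU hQU
    filter_upwards [prod_mem_nhds ((isOpen_setOf_subset hW).mem_nhds hQW)
      (prod_mem_nhds hV ((isOpen_setOf_subset hW').mem_nhds hRW'))]
    rintro ⟨Q', b, R'⟩ ⟨hQ', hb, hR'⟩
    exact hUS _ ((bary_subset_iff hU).2 fun x hx y hy => h b hb x (hQ' hx) y (hR' hy))

theorem scottContinuous_bary (a : I) :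
    ScottContinuous fun p : Smyth B × Smyth B => bary a p.1 p.2 := by
  intro D hne hD p hp
  obtain ⟨hp₁, hp₂⟩ := isLUB_prod.1 hp
  refine ⟨?_, fun R hR y hy => ?_⟩
  · rintro _ ⟨q, hq, rfl⟩
    exact bary_mono a (hp.1 hq).1 (hp.1 hq).2
  · by_contra hyp
    obtain ⟨U, hU, hpU, hyU⟩ := exists_isOpen_of_notMem hyp
    obtain ⟨V, hV, W, hW, hW₁, W', hW', hW₂, h⟩ := exists_isOpen_bary_subset hU hpU
    obtain ⟨_, ⟨q, hq, rfl⟩, hqW⟩ := exists_subset_of_isLUB (hne.image _)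
      (directedOn_image.2 (hD.mono fun {_ _} h => h.1)) hp₁ hW hW₁
    obtain ⟨_, ⟨q', hq', rfl⟩, hqW'⟩ := exists_subset_of_isLUB (hne.image _)
      (directedOn_image.2 (hD.mono fun {_ _} h => h.2)) hp₂ hW' hW₂
    obtain ⟨d, hd, hqd, hqd'⟩ := hD q hq q' hq'
    have hdU : (bary a d.1 d.2).carrier ⊆ U := (bary_subset_iff hU).2 fun x hx y hy =>
      h a (mem_of_mem_nhds hV) x (hqW (hqd.1 hx)) y (hqW' (hqd'.2 hy))
    exact hyU (hdU (hR ⟨d, hd, rfl⟩ hy))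

variable (B) in
theorem isDBarycentric : IsDBarycentric (Smyth B) where
  monotone_bary a := fun _ _ h => bary_mono a h.1 h.2
  scottContinuous_bary := scottContinuous_bary
  continuous_weight _ _ := continuous_bary continuous_id continuous_const continuous_const
  isDcpo _ hne hD := by
    obtain ⟨Q, -, hQ⟩ := exists_carrier_eq_biInter hne hD
    exact ⟨Q, hQ⟩

theorem lowerSemicontinuous_lowerValue {Λ : B → ℝ≥0∞} (hΛ : LowerSemicontinuous Λ) :
    LowerSemicontinuous (lowerValue Λ : Smyth B → ℝ≥0∞) := by
  refine lowerSemicontinuous_iff_isOpen_preimage.2 fun r => ?_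
  convert! isOpen_setOf_subset (hΛ.isOpen_preimage r) using 1
  ext Q
  exact lt_lowerValue_iff hΛ

/-- Combining minimizers gives one inequality. For the other, `Λ` is monotone for specialization, so
the upward closure adds no smaller values. -/
theorem isAffine_lowerValue {Λ : B → ℝ≥0∞} (hΛ : LowerSemicontinuous Λ)
    (ha : IsAffineENNReal Λ) : IsAffineENNReal (lowerValue Λ : Smyth B → ℝ≥0∞) := by
  intro a Q R
  obtain ⟨x, hx, hQ⟩ := exists_lowerValue_eq hΛ Q
  obtain ⟨y, hy, hR⟩ := exists_lowerValue_eq hΛ R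
  refine le_antisymm ?_ (le_iInf₂ fun z hz => ?_)
  · rw [hQ, hR, ← ha]
    exact iInf₂_le _ (bary_mem hx hy)
  · obtain ⟨x', hx', y', hy', hz⟩ := mem_add.1 hz
    have hle : Λ (bary a x' y') ≤ Λ z := by
      by_contra! hlt
      exact lt_irrefl (Λ z) (hz.mem_open (s := {w | Λ z < Λ w}) (hΛ.isOpen_preimage (Λ z)) hlt)
    refine le_trans ?_ hle
    rw [ha]
    exact add_le_add (mul_le_mul_right (iInf₂_le x' hx') _) (mul_le_mul_right (iInf₂_le y' hy') _)

variable (B) in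
theorem linearlySeparated : LinearlySeparated (Smyth B) := by
  intro Q R hQR
  rw [specializes_iff_le] at hQR
  obtain ⟨y, hyR, hyQ⟩ := not_subset.1 hQR
  obtain ⟨Λ, ha, hc, hy, hQ⟩ := IsConvenient.linearlySeparated.exists_affine_lt Q hyQ
  exact ⟨lowerValue Λ, isAffine_lowerValue hc ha, lowerSemicontinuous_lowerValue hc,
    ((iInf₂_le y hyR).trans hy).trans_lt ((lt_lowerValue_iff hc).2 hQ)⟩

variable (B) in
theorem locallyConvexCompact : LocallyConvexCompact (Smyth B) := by
  intro Q S hS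
  obtain ⟨S', hS'S, hS', hQ⟩ := mem_nhds_iff.1 hS
  obtain ⟨U, hU, hQU, h⟩ := exists_isOpen_of_mem hS' hQ
  obtain ⟨Q', hQ', hQ'U⟩ := exists_subset_interior Q hU hQU
  refine ⟨Ici Q', ?_, ?_, ?_, fun R hR => hS'S (h R (Subset.trans hR hQ'U))⟩
  · filter_upwards [(isOpen_setOf_subset isOpen_interior).mem_nhds hQ'] with R hR
    exact hR.trans interior_subset
  · intro R hR R' hR' a
    have := bary_mono a (mem_Ici.1 hR) (mem_Ici.1 hR')
    rwa [bary_self] at this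
  · refine isCompact_of_finite_subcover fun V hV hcov => ?_
    -- Scott-open sets are upper sets, so one that contains the least element `Q'` covers `Ici Q'`.
    obtain ⟨i, hi⟩ := mem_iUnion.1 (hcov self_mem_Ici)
    refine ⟨{i}, fun R hR => ?_⟩
    simpa using Topology.IsScott.isUpperSet_of_isOpen (D := univ) (hV i) hR hi

/-- The generic point of `C` is the supremum of `E`, the neighborhoods of members of `C`.
Irreducibility makes `E` directed, and `C`, being Scott-closed, contains its supremum. -/
instance : QuasiSober (Smyth B) where
  sober {C} hirr hC := by
    have hlow : IsLowerSet C := Topology.IsScott.isLowerSet_of_isClosed hC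
    set E : Set (Smyth B) := {Q' | ∃ Q ∈ C, Q.carrier ⊆ interior Q'.carrier} with hE
    have hEne : E.Nonempty := by
      obtain ⟨Q, hQ⟩ := hirr.nonempty
      obtain ⟨Q', h⟩ := setOf_subset_interior_nonempty Q
      exact ⟨Q', Q, hQ, h⟩
    have hEC : E ⊆ C := by
      rintro Q' ⟨Q, hQ, h⟩
      exact hlow (h.trans interior_subset) hQ
    have hEd : DirectedOn (· ≤ ·) E := by
      rintro Q₁ ⟨R₁, hR₁, h₁⟩ Q₂ ⟨R₂, hR₂, h₂⟩
      obtain ⟨Q, hQ, hQ₁, hQ₂⟩ := hirr.isPreirreducible _ _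
        (isOpen_setOf_subset (isOpen_interior (s := Q₁.carrier)))
        (isOpen_setOf_subset (isOpen_interior (s := Q₂.carrier))) ⟨R₁, hR₁, h₁⟩ ⟨R₂, hR₂, h₂⟩
      obtain ⟨Q', h, h₁', h₂'⟩ := directedOn_setOf_subset_interior Q Q₁ hQ₁ Q₂ hQ₂
      exact ⟨Q', ⟨Q, hQ, h⟩, h₁', h₂'⟩
    obtain ⟨s, -, hs⟩ := exists_carrier_eq_biInter hEne hEd
    refine ⟨s, ?_⟩
    rw [isGenericPoint_def, Topology.IsScott.closure_singleton]
    refine Subset.antisymm (fun R hR => hlow hR ?_) fun Q hQ => ?_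
    · exact Topology.IsScott.dirSupClosed_of_isClosed hC hEC hEne hEd hs
    · exact (isLUB_setOf_subset_interior Q).2 fun Q' h => hs.1 ⟨Q, hQ, h⟩

instance : IsConvenient (Smyth B) where
  linearlySeparated := linearlySeparated B
  locallyConvexCompact := locallyConvexCompact B

end Smyth

end BarycentricAlgebra

theorem mainTheorem12 {B : Type*} [TopologicalSpace B] [BarycentricAlgebra B]
    [BarycentricAlgebra.IsConvenient B] :
    -- a continuous d-barycentric algebra, linearly separated in its Scott topology
    BarycentricAlgebra.IsDBarycentric (BarycentricAlgebra.Smyth B) ∧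
    BarycentricAlgebra.IsContinuousPoset (BarycentricAlgebra.Smyth B) ∧
    BarycentricAlgebra.LinearlySeparated (BarycentricAlgebra.Smyth B) ∧
    -- hence convenient
    BarycentricAlgebra.IsConvenient (BarycentricAlgebra.Smyth B) ∧
    -- directed suprema are filtered intersections
    (∀ D : Set (BarycentricAlgebra.Smyth B), D.Nonempty → DirectedOn (· ≤ ·) D →
      ∃ Q : BarycentricAlgebra.Smyth B,
        Q.carrier = ⋂ Q' ∈ D, Q'.carrier ∧ IsLUB D Q) ∧
    -- the upper Vietoris topology is the Scott topology
    BarycentricAlgebra.Smyth.upperVietoris B =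
      Topology.scott (BarycentricAlgebra.Smyth B) Set.univ :=
  ⟨BarycentricAlgebra.Smyth.isDBarycentric B, BarycentricAlgebra.Smyth.isContinuousPoset B,
    BarycentricAlgebra.Smyth.linearlySeparated B, inferInstance,
    fun _ hne hD => BarycentricAlgebra.Smyth.exists_carrier_eq_biInter hne hD,
    BarycentricAlgebra.Smyth.upperVietoris_eq_scott B⟩
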